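/- Conventions. Let $\sigma(u)=\max\{0,u\}$, acting componentwise. A filter of length $s\in\mathbb N$ is a vector $w=(w_0,\dots,w_s)$, and for a $K$-dimensional input it gives the $(K+s)\times K$ matrix $T^w=[w_{i-k}]$ (with $w_i=0$ for $i\notin\{0,\dots,s\}$). Let $\mathcal D_m(v)=(v_{im})_{i=1}^{\lfloor K/m\rfloor}$ for $v\in\mathbb R^K$. A DCNN of depth $J$ with filter length $s$ on $\mathbb R^d$ has widths $d_0=d$, $d_j=d_{j-1}+s$ and layers $h^{(0)}(x)=x$, $h^{(j)}(x)=\sigma(T^{(j)}h^{(j-1)}(x)-b^{(j)})$, where $T^{(j)}=T^{w^{(j)}}$, with filters $w^{(j)}$ and bias vectors $b^{(j)}\in\mathbb R^{d_j}$. If it is downsampled at layer $J_1$, then at $j=J_1$ the width is $d_{J_1}=\lfloor (d_{J_1-1}+s)/d\rfloor$ and $T^{(J_1)}h^{(J_1-1)}$ is replaced by $\mathcal D_d(T^{(J_1)}h^{(J_1-1)})$. The output functions of one such network are the functions $c\cdot h^{(J)}+a$ with $c\in\mathbb R^{d_J}$, $a\in\mathbb R$. The hypothesis space $\mathcal H_{J,s}$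 is the set of all output functions, over all filters, biases, $c$ and $a$. Given data, $\mathcal H_{int,J,s}$ is the set of those output functions of downsampled DCNNs of depth $J$ and filter length $s$ that satisfy $f(x^i)=y^i$ for $i=1,\dots,n$. Let $\Omega\subset\mathbb R^d$ be closed and bounded, $M\ge 1$, $\rho$ a probability distribution on $\Omega\times[-M,M]$ with marginal $\rho_\Omega$ on $\Omega$ and regression function $f_\rho(x)=\int y\,d\rho(y|x)$, let $\|\cdot\|_2$ be the norm of $L^2(\rho_\Omega)$, and let $\pi_M f$ be the truncation of $f$ to $[-M,M]$. Let $D=\{(x^i,y^i)\}_{i=1}^n$, $n\ge1$, be drawn independently from $\rho$. Theorem 1. Let $d\ge 2$, $1\le S\le d/2$, $J_2\ge 1$ and $s=2S$. Suppose that $\rho_\Omega(\{x\})=0$ for every $x\in\Omega$ and that $$\inf_{f\in\mathcal H_{J_2,S}}\|\pi_M f-f_\rho\|_2<E_{J_2}$$ for some $E_{J_2}>0$, where $\mathcal H_{J_2,S}$ is the hypothesis space without downsampling. Let $N\ge 3n$ be any odd integer, and put $J_1=\left\lceil\frac{2d^2}{s-1}\right\rceil$ and $J_3=\left\lceil\frac{(N-1)\,d_{J_1+J_2}}{s}\right\rceil$,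 where $d_j$ are the widths of the DCNN with filter length $s$ downsampled at layer $J_1$. Then, almost surely with respect to the sample $D$, $$\inf_{f\in\mathcal H_{int,J_1+J_2+J_3,s}}\|\pi_M f-f_\rho\|_2<E_{J_2}.$$ Moreover, the interpolating network can be taken from a deepening of a DCNN of depth $J_2$ with $$d_{J_1+J_2+J_3}+J_1(s+2)+3$$ additional free parameters, in the following sense. There are fixed filters for the last $J_3$ layers and a rule for the biases, depending only on $d,S,n,N,J_2,\Omega$, which assign to every DCNN (teacher) of depth $J_2$ with filter length $S$, to all data $D$, to all filters $u=(u^{(1)},\dots,u^{(J_1)})$ of length $s$ and all scalars $\beta_0,\dots,\beta_{J_1},\tau$ a DCNN (student) of depth $J_1+J_2+J_3$ with filter length $s$ and downsampling at layer $J_1$, such that: (i) the first $J_1$ layers have the filters $u^{(j)}$ and the biases $b^{(j)}=\beta_{j-1}T^{(j)}\mathbf 1-\beta_j\mathbf 1$ (with $T^{(j)}\mathbf 1$ replaced by $\mathcal D_d(T^{(j)}\mathbf 1)$ for $j=J_1$); the next $J_2$ layers have the filters of the teacher, placed on the even positions $0,2,\dots,2S$ (with zeros on the odd ones), and biases determined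 by the teacher, $u$ and $\beta$; the last $J_3$ layers have the fixed filters, and biases determined by the teacher, $D$, $u$, $\beta$ and $\tau$; (ii) for every teacher and all data, the family of all output functions $c\cdot h^{(J_1+J_2+J_3)}+a$ of the students, each described by its filters, biases, $c$ and $a$, has exactly $d_{J_1+J_2+J_3}+J_1(s+2)+3$ free parameters: it is the image of the real space of that dimension under a locally Lipschitz map that is injective on a dense open set; (iii) there is a teacher, not depending on the data, whose output functions satisfy $\inf\|\pi_M f-f_\rho\|_2<E_{J_2}$, and for which almost surely there are $u,\beta,\tau$ such that the interpolating output functions $f$ of the corresponding student satisfy $\inf\|\pi_M f-f_\rho\|_2<E_{J_2}$. -/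

import Mathlib

open MeasureTheory ProbabilityTheory Set
open scoped ENNReal Matrix

/-- The `(K + s) × K` convolutional (Toeplitz) matrix `T^w = [w_{i-k}]` of a filter
`w` supported in `{0, …, s}`. -/
def convMatrix {s : ℕ} (K : ℕ) (w : Fin (s + 1) → ℝ) : Matrix (Fin (K + s)) (Fin K) ℝ :=
  Matrix.of fun i k =>
    if h : (k : ℕ) ≤ i ∧ (i : ℕ) - k ≤ s then w ⟨(i : ℕ) - k, Nat.lt_succ_of_le h.2⟩ else 0

theorem downsample_index {K m : ℕ} (i : Fin (K / m)) : ((i : ℕ) + 1) * m - 1 < K := by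
  have hi := i.isLt
  rcases Nat.eq_zero_or_pos m with rfl | hm
  · simp at hi
  · have h1 : ((i : ℕ) + 1) * m ≤ K := (Nat.le_div_iff_mul_le hm).1 hi
    have h2 : 0 < ((i : ℕ) + 1) * m := Nat.mul_pos (Nat.succ_pos _) hm
    omega

/-- The downsampling operator `𝒟_m : ℝ^K → ℝ^⌊K/m⌋`, which keeps the entries with (one-based)
positions `m, 2m, …, ⌊K/m⌋ m`. -/
def downsample {K : ℕ} (m : ℕ) (v : Fin K → ℝ) : Fin (K / m) → ℝ :=
  fun i => v ⟨((i : ℕ) + 1) * m - 1, downsample_index i⟩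

/-- Widths `d_0 = d`, `d_j = ⌊(d_{j-1} + s) / m_j⌋`, where `m_j` is the scaling parameter of
the downsampling at layer `j` (`m_j = 1`: no downsampling). -/
def width (d s : ℕ) (m : ℕ → ℕ) : ℕ → ℕ
  | 0 => d
  | j + 1 => (width d s m j + s) / m (j + 1)

/-- Scaling parameters of a DCNN without downsampling. -/
def plain : ℕ → ℕ := fun _ => 1

/-- Scaling parameters of a DCNN downsampled with parameter `d` at layer `J₁` only. -/
def downAt (d J₁ : ℕ) : ℕ → ℕ := fun j => if j = J₁ then d else 1

theorem width_plain (d s j : ℕ) : width d s plain j = d + j * s := by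
  induction j with
  | zero => simp [width]
  | succ j ih => simp only [width, plain, Nat.div_one] at ih ⊢; rw [ih]; ring

theorem width_downAt_of_ne (d s J₁ j : ℕ) (h : j + 1 ≠ J₁) :
    width d s (downAt d J₁) (j + 1) = width d s (downAt d J₁) j + s := by
  simp [width, downAt, h]

theorem width_downAt_self (d s j : ℕ) :
    width d s (downAt d (j + 1)) (j + 1) = (width d s (downAt d (j + 1)) j + s) / d := by
  simp [width, downAt]

/-- Filters and bias vectors of a DCNN of depth `J` with filter length `s` and input dimension
`d`. Component `j : Fin J` belongs to layer `j + 1`. -/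
abbrev Weights (d s : ℕ) (m : ℕ → ℕ) (J : ℕ) : Type :=
  (Fin J → Fin (s + 1) → ℝ) × ((j : Fin J) → Fin (width d s m ((j : ℕ) + 1)) → ℝ)

/-- The function vectors `h^(0)(x) = x`,
`h^(j)(x) = σ(𝒟_{m_j}(T^(j) h^(j-1)(x)) - b^(j))` with the ReLU `σ(u) = max 0 u`. -/
def layer {d s : ℕ} {m : ℕ → ℕ} {J : ℕ} (p : Weights d s m J) (x : Fin d → ℝ) :
    (j : ℕ) → j ≤ J → Fin (width d s m j) → ℝ
  | 0, _ => x
  | j + 1, hj => fun i =>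
      max 0 (downsample (m (j + 1))
        (convMatrix (width d s m j) (p.1 ⟨j, hj⟩) *ᵥ layer p x j (Nat.le_of_succ_le hj)) i
          - p.2 ⟨j, hj⟩ i)

/-- The output functions `x ↦ c · h^(J)(x) + a` of one DCNN with given filters and biases. -/
def outputs {d s : ℕ} {m : ℕ → ℕ} {J : ℕ} (p : Weights d s m J) : Set ((Fin d → ℝ) → ℝ) :=
  {f | ∃ (c : Fin (width d s m J) → ℝ) (a : ℝ), f = fun x => c ⬝ᵥ layer p x J le_rfl + a}

/-- The hypothesis space: all output functions, over all filters, biases and coefficients. -/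
def hypothesisSpace (d s : ℕ) (m : ℕ → ℕ) (J : ℕ) : Set ((Fin d → ℝ) → ℝ) :=
  {f | ∃ p : Weights d s m J, f ∈ outputs p}

/-- A data set `D = ((x^i, y^i))_{i=1}^n`. -/
abbrev Sample (d n : ℕ) : Type := Fin n → (Fin d → ℝ) × ℝ

/-- The functions that interpolate the data. -/
def interpolants {d n : ℕ} (D : Sample d n) : Set ((Fin d → ℝ) → ℝ) :=
  {f | ∀ i, f (D i).1 = (D i).2}

/-- The truncation `π_M` onto `[-M, M]`. -/
def truncation (M t : ℝ) : ℝ := max (-M) (min M t)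

/-- The regression function `f_ρ(x) = ∫ y dρ(y|x)`. -/
noncomputable def regressionFunction {d : ℕ} (ρ : Measure ((Fin d → ℝ) × ℝ))
    [IsFiniteMeasure ρ] (x : Fin d → ℝ) : ℝ :=
  ∫ y, y ∂(ρ.condKernel x)

/-- `‖π_M f - f_ρ‖₂`, the norm of `L²` with respect to the marginal of `ρ` on the inputs. -/
noncomputable def truncError {d : ℕ} (ρ : Measure ((Fin d → ℝ) × ℝ)) [IsFiniteMeasure ρ]
    (M : ℝ) (f : (Fin d → ℝ) → ℝ) : ℝ≥0∞ :=
  eLpNorm (fun x => truncation M (f x) - regressionFunction ρ x) 2 ρ.fst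

/-- `inf_{f ∈ F} ‖π_M f - f_ρ‖₂` (equal to `∞` if `F` is empty). -/
noncomputable def infError {d : ℕ} (ρ : Measure ((Fin d → ℝ) × ℝ)) [IsFiniteMeasure ρ]
    (M : ℝ) (F : Set ((Fin d → ℝ) → ℝ)) : ℝ≥0∞ :=
  ⨅ f ∈ F, truncError ρ M f

/-- `J₁ = ⌈2d² / (s - 1)⌉`. -/
def depthOne (d s : ℕ) : ℕ := ⌈(2 * (d : ℚ) ^ 2) / ((s : ℚ) - 1)⌉₊

/-- `J₃ = ⌈(N - 1) d_{J₁+J₂} / s⌉`. -/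
def depthThree (d s J₁ J₂ N : ℕ) : ℕ :=
  ⌈((N : ℚ) - 1) * (width d s (downAt d J₁) (J₁ + J₂) : ℚ) / (s : ℚ)⌉₊

/-- The set `F` is described by exactly `k` free real parameters: it is the image of `ℝ^k` under
a locally Lipschitz map that is one-to-one on a dense open set. -/
def HasFreeParameters {W : Type*} [PseudoEMetricSpace W] (F : Set W) (k : ℕ) : Prop :=
  ∃ Φ : (Fin k → ℝ) → W, LocallyLipschitz Φ ∧ Set.range Φ = F ∧
    ∃ U : Set (Fin k → ℝ), IsOpen U ∧ Dense U ∧ Set.InjOn Φ U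

/-- The filter of length `2S` that carries a filter of length `S` on the even positions. -/
def dilate {S : ℕ} (w : Fin (S + 1) → ℝ) : Fin (2 * S + 1) → ℝ :=
  fun i => if (i : ℕ) % 2 = 0 then w ⟨(i : ℕ) / 2, by have := i.isLt; omega⟩ else 0

/-- A deepening rule for DCNNs of depth `J₂` and filter length `S` (teachers), uniform in the
teacher and in the data. It fixes the filters of the last `J₃` layers of the deepened network
once and for all, and says how the biases are determined by the teacher, the data, the filters
`u` of the first `J₁` layers, the scalars `β₀, …, β_{J₁}` and one more scalar `τ`.
Only the entries of `midBias` at layers `J₁+1, …, J₁+J₂` and of `tailBias` at the last `J₃`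
layers are used. -/
structure DeepeningRule (d S n J₁ J₂ J₃ : ℕ) where
  tailFilter : Fin J₃ → Fin (2 * S + 1) → ℝ
  midBias : Weights d S plain J₂ → (Fin J₁ → Fin (2 * S + 1) → ℝ) → (Fin (J₁ + 1) → ℝ) →
    (j : Fin (J₁ + J₂ + J₃)) → Fin (width d (2 * S) (downAt d J₁) ((j : ℕ) + 1)) → ℝ
  tailBias : Weights d S plain J₂ → Sample d n →
    (Fin J₁ → Fin (2 * S + 1) → ℝ) → (Fin (J₁ + 1) → ℝ) → ℝ →
    (j : Fin (J₁ + J₂ + J₃)) → Fin (width d (2 * S) (downAt d J₁) ((j : ℕ) + 1)) → ℝ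

namespace DeepeningRule

variable {d S n J₁ J₂ J₃ : ℕ}

/-- The deepened network: `J₁` new layers with filters `u` and biases
`b^(j) = β_{j-1} 𝒟_{m_j}(T^(j) 1) - β_j 1`; then `J₂` layers with the dilated filters of the
teacher `q`; then `J₃` layers with the fixed filters of the rule. -/
def student (R : DeepeningRule d S n J₁ J₂ J₃) (q : Weights d S plain J₂) (D : Sample d n)
    (u : Fin J₁ → Fin (2 * S + 1) → ℝ) (β : Fin (J₁ + 1) → ℝ) (τ : ℝ) :
    Weights d (2 * S) (downAt d J₁) (J₁ + J₂ + J₃) where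
  fst := fun j =>
    if h₁ : (j : ℕ) < J₁ then u ⟨j, h₁⟩
    else if h₂ : (j : ℕ) < J₁ + J₂ then dilate (q.1 ⟨(j : ℕ) - J₁, by omega⟩)
    else R.tailFilter ⟨(j : ℕ) - (J₁ + J₂), by have := j.isLt; omega⟩
  snd := fun j =>
    if h₁ : (j : ℕ) < J₁ then fun i =>
      β ⟨j, by omega⟩ *
          downsample (downAt d J₁ ((j : ℕ) + 1))
            (convMatrix (width d (2 * S) (downAt d J₁) j) (u ⟨j, h₁⟩) *ᵥ fun _ => (1 : ℝ)) i
        - β ⟨(j : ℕ) + 1, by omega⟩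
    else if (j : ℕ) < J₁ + J₂ then R.midBias q u β j
    else R.tailBias q D u β τ j

/-- All parametrizations `((filters, biases), c, a)` of output functions `c · h^(J) + a` of
deepened networks with a given teacher and given data. -/
def family (R : DeepeningRule d S n J₁ J₂ J₃) (q : Weights d S plain J₂) (D : Sample d n) :
    Set (Weights d (2 * S) (downAt d J₁) (J₁ + J₂ + J₃) ×
      (Fin (width d (2 * S) (downAt d J₁) (J₁ + J₂ + J₃)) → ℝ) × ℝ) :=
  {t | ∃ u β τ, t.1 = R.student q D u β τ}

end DeepeningRule

/-!
A vector is identified with the polynomial whose coefficients are its entries. A convolution layer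
then multiplies by the polynomial of its filter (`convMatrix_mulVec_coeff`), and where all
pre-activations are nonnegative the ReLU does nothing, so that a block of layers multiplies by the
product of its filters (`layer_affine_block`); the biases see to nonnegativity on the bounded set
`Ω` by adding a large constant, and remove the constant of the layer before. Irreducible real
polynomials have degree at most two, so every polynomial of degree at most `2SJ` is a product of
`J` filters of length `2S` (`exists_prod_ofFn_eq`).

The first `J₁` layers have total length at least `2d²`, and the downsampling by `d` reads off
inner products of `x` with disjoint blocks of `d` coefficients. Hence the filters `u` can be chosen
such that layer `J₁` contains `x` on the even positions `0, 2, …, 2d - 2` and an arbitrary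
projection `ξ · x` on position `1` (`exists_routing`). Dilated filters do not mix even and odd
positions. So the next `J₂` layers compute the teacher on the even positions, while the leading
coefficients of the teacher's filters move a nonzero multiple of `ξ · x` through the odd ones, all
other odd positions being switched off by their biases (`max_midState_succ`). The fixed filters of
the last `J₃` layers multiply to `∑_{m < N} X^{mK}`, where `K` is the width reached so far: they
produce `N ≥ 3n` copies of everything (`exists_copy_filters`). The last biases turn three
copies of the projection per datum into ReLUs with knots at the projected datum and at distance
`± τ` from it, and the output functions are those of the teacher plus arbitrary combinations of hats
of half width `τ` around the data (`exists_output_student`).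

A teacher with a vanishing filter has constant outputs only and can be replaced
(`exists_teacher_filters_ne_zero`). As the marginal has no atoms, the inputs of the data are almost
surely distinct, and by Fubini almost every direction `ξ` separates them and gives measure
zero to the hyperplanes through them (`ae_ae_dotProduct_ne`). As `τ → 0` the hats become disjoint at
the data, so they interpolate, and the measure of their supports tends to zero; since truncated
functions are bounded by `M`, so does the additional error (`truncError_le_add`).

The network depends on the filters `u`, the scalars `β`, `τ` and the output coefficients in a
polynomial way, and they can be read off from its filters and biases if the second entry of the
first filter is nonzero (`injOn_parametrization`); this is the count of free parameters.
-/

section Construction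

open Polynomial Finset

/-! ### Factoring real polynomials into filters -/

/-- Over `ℝ` one can always split off a factor of degree at most two in such a way that the bound
on the degree drops by two: take an irreducible quadratic factor or two linear ones. -/
theorem exists_quadratic_factor (b : ℕ) (P : ℝ[X]) (hP : P.natDegree ≤ 2 * b + 2) :
    ∃ A B : ℝ[X], P = A * B ∧ A.natDegree ≤ 2 ∧ B.natDegree ≤ 2 * b := by
  have irr : ∀ Q : ℝ[X], 1 ≤ Q.natDegree → ∃ A B : ℝ[X], Q = A * B ∧ B ≠ 0 ∧
      (A.natDegree = 1 ∨ A.natDegree = 2) ∧ Q.natDegree = A.natDegree + B.natDegree := by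
    intro Q hQ
    have hQ0 : Q ≠ 0 := by rintro rfl; simp at hQ
    obtain ⟨A, hA, B, rfl⟩ := exists_irreducible_of_natDegree_pos hQ
    obtain ⟨hA0, hB0⟩ := mul_ne_zero_iff.1 hQ0
    refine ⟨A, B, rfl, hB0, ?_, natDegree_mul hA0 hB0⟩
    have h1 : A.natDegree ≤ 2 := natDegree_le_of_degree_le hA.degree_le_two
    have h2 : 0 < A.natDegree := hA.natDegree_pos
    omega
  by_cases h : P.natDegree ≤ 2
  · exact ⟨P, 1, by simp, h, by simp⟩
  obtain ⟨A, B, rfl, hB0, hA | hA, hdeg⟩ := irr P (by omega)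
  · obtain ⟨A', B', rfl, hB0', hA' | hA', hdeg'⟩ := irr B (by omega)
    · exact ⟨A * A', B', by ring, (natDegree_mul_le).trans (by omega), by omega⟩
    · exact ⟨A', A * B', by ring, by omega, (natDegree_mul_le).trans (by omega)⟩
  · exact ⟨A, B, rfl, by omega, by omega⟩

theorem exists_even_factor (a b : ℕ) (P : ℝ[X]) (hP : P.natDegree ≤ 2 * a + 2 * b) :
    ∃ A B : ℝ[X], P = A * B ∧ A.natDegree ≤ 2 * a ∧ B.natDegree ≤ 2 * b := by
  induction a generalizing b with
  | zero => exact ⟨1, P, by simp, by simp, by omega⟩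
  | succ a ih =>
    obtain ⟨A, B, rfl, hA, hB⟩ := ih (b + 1) (by omega)
    obtain ⟨C, B', rfl, hC, hB'⟩ := exists_quadratic_factor b B (by omega)
    exact ⟨A * C, B', by ring, (natDegree_mul_le).trans (by omega), hB'⟩

theorem natDegree_ofFn_le {s : ℕ} (w : Fin (s + 1) → ℝ) : (ofFn (s + 1) w).natDegree ≤ s :=
  Nat.lt_succ_iff.1 (ofFn_natDegree_lt (by omega) w)

/-- A convolution of total length `2SJ` is a cascade of `J` filters of length `2S`. -/
theorem exists_prod_ofFn_eq (S J : ℕ) (P : ℝ[X]) (hP : P.natDegree ≤ 2 * S * (J + 1)) :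
    ∃ u : Fin (J + 1) → Fin (2 * S + 1) → ℝ, ∏ j, ofFn (2 * S + 1) (u j) = P := by
  induction J generalizing P with
  | zero =>
    refine ⟨fun _ => toFn (2 * S + 1) P, ?_⟩
    rw [Fin.prod_univ_one]
    exact ofFn_comp_toFn_eq_id_of_natDegree_lt (by omega)
  | succ J ih =>
    obtain ⟨A, B, rfl, hA, hB⟩ := exists_even_factor S (S * (J + 1)) P (hP.trans (by ring_nf; omega))
    obtain ⟨u, hu⟩ := ih B (hB.trans (by ring_nf; omega))
    refine ⟨Fin.cons (toFn (2 * S + 1) A) u, ?_⟩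
    rw [Fin.prod_univ_succ]
    simp only [Fin.cons_zero, Fin.cons_succ, hu]
    rw [ofFn_comp_toFn_eq_id_of_natDegree_lt (by omega)]

/-! ### Convolution layers as polynomial multiplication -/

theorem convMatrix_mulVec_coeff {s K : ℕ} (w : Fin (s + 1) → ℝ) (P : ℝ[X])
    (hP : P.natDegree < K) (i : Fin (K + s)) :
    (convMatrix K w *ᵥ fun k => P.coeff k) i = (ofFn (s + 1) w * P).coeff i := by
  have hi := i.isLt
  have h1 : (convMatrix K w *ᵥ fun k => P.coeff k) i =
      ∑ k ∈ range K, (if k ≤ i then (ofFn (s + 1) w).coeff (i - k) else 0) * P.coeff k := by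
    rw [← Fin.sum_univ_eq_sum_range
      (fun k : ℕ => (if k ≤ (i : ℕ) then (ofFn (s + 1) w).coeff (i - k) else 0) * P.coeff k) K]
    unfold Matrix.mulVec dotProduct
    refine Finset.sum_congr rfl fun k _ => ?_
    simp only [convMatrix, Matrix.of_apply]
    congr 1
    by_cases hk : (k : ℕ) ≤ i
    · by_cases hs : (i : ℕ) - k ≤ s
      · rw [dif_pos ⟨hk, hs⟩, if_pos hk, ofFn_coeff_eq_val_of_lt _ (Nat.lt_succ_of_le hs)]
      · rw [dif_neg (fun h => hs h.2), if_pos hk, ofFn_coeff_eq_zero_of_ge _ (by omega)]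
    · rw [dif_neg (fun h => hk h.1), if_neg hk]
  rw [h1, mul_comm (ofFn (s + 1) w), coeff_mul,
    Finset.Nat.sum_antidiagonal_eq_sum_range_succ (fun a b => P.coeff a * (ofFn (s + 1) w).coeff b)]
  have h2 : ∀ k ∈ range (K + s), k ∉ range K →
      (if k ≤ (i : ℕ) then (ofFn (s + 1) w).coeff (i - k) else 0) * P.coeff k = 0 := by
    intro k _ hk
    rw [coeff_eq_zero_of_natDegree_lt (n := k) (by simp at hk; omega), mul_zero]
  rw [Finset.sum_subset (range_subset_range.2 (by omega)) h2, ← Finset.sum_subset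
    (s₁ := range (i + 1)) (s₂ := range (K + s)) (range_subset_range.2 (by omega))]
  · refine Finset.sum_congr rfl fun k hk => ?_
    rw [if_pos (by simp at hk; omega), mul_comm]
  · intro k _ hk
    rw [if_neg (by simp at hk; omega), zero_mul]

/-- The filter of layer `j + 1` as a polynomial (`1` beyond the depth of the network). -/
noncomputable def filterPoly {d s : ℕ} {m : ℕ → ℕ} {J : ℕ} (p : Weights d s m J) (j : ℕ) : ℝ[X] :=
  if h : j < J then ofFn (s + 1) (p.1 ⟨j, h⟩) else 1

theorem filterPoly_of_lt {d s : ℕ} {m : ℕ → ℕ} {J : ℕ} (p : Weights d s m J) {j : ℕ} (h : j < J) :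
    filterPoly p j = ofFn (s + 1) (p.1 ⟨j, h⟩) := dif_pos h

theorem natDegree_filterPoly_le {d s : ℕ} {m : ℕ → ℕ} {J : ℕ} (p : Weights d s m J) (j : ℕ) :
    (filterPoly p j).natDegree ≤ s := by
  unfold filterPoly
  split_ifs
  · exact natDegree_ofFn_le _
  · simp

/-- The pre-activation that a constant input `1` produces at layer `j + 1`. -/
noncomputable def onesResponse {d s : ℕ} {m : ℕ → ℕ} {J : ℕ} (p : Weights d s m J) (j : Fin J) :
    Fin (width d s m ((j : ℕ) + 1)) → ℝ :=
  downsample (m ((j : ℕ) + 1)) (convMatrix (width d s m j) (p.1 j) *ᵥ fun _ => (1 : ℝ))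

/-- One layer applied to an input of the form `P + c·1`. -/
theorem layer_succ_of_eq {d s : ℕ} {m : ℕ → ℕ} {J : ℕ} (p : Weights d s m J) (x : Fin d → ℝ)
    {j : ℕ} (hj : j + 1 ≤ J) {P : ℝ[X]} {c : ℝ} (hP : P.natDegree < width d s m j)
    (h : ∀ i, layer p x j (Nat.le_of_succ_le hj) i = P.coeff i + c)
    (i : Fin (width d s m (j + 1))) :
    layer p x (j + 1) hj i =
      max 0 ((filterPoly p j * P).coeff (((i : ℕ) + 1) * m (j + 1) - 1)
        + c * onesResponse p ⟨j, hj⟩ i - p.2 ⟨j, hj⟩ i) := by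
  have h' : layer p x j (Nat.le_of_succ_le hj) =
      (fun k : Fin (width d s m j) => P.coeff k) + c • fun _ => (1 : ℝ) := by
    funext i; simp [h i]
  rw [filterPoly_of_lt p hj, layer, h', Matrix.mulVec_add, Matrix.mulVec_smul]
  simp only [downsample, onesResponse, Pi.add_apply, Pi.smul_apply, smul_eq_mul]
  rw [convMatrix_mulVec_coeff _ _ hP]

theorem continuous_layer {d s : ℕ} {m : ℕ → ℕ} {J : ℕ} (p : Weights d s m J) (j : ℕ) (hj : j ≤ J) :
    Continuous fun x : Fin d → ℝ => layer p x j hj := by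
  induction j with
  | zero => exact continuous_id
  | succ j ih =>
    refine continuous_pi fun i => ?_
    simp only [layer, downsample]
    refine continuous_const.max (Continuous.sub ?_ continuous_const)
    exact (continuous_apply _).comp (continuous_const.matrix_mulVec (ih _))

/-- The `ℓ¹` norm of the coefficients of a polynomial. -/
noncomputable def coeffNorm (P : ℝ[X]) : ℝ := P.sum fun _ a => |a|

theorem coeffNorm_nonneg (P : ℝ[X]) : 0 ≤ coeffNorm P :=
  Finset.sum_nonneg fun _ _ => abs_nonneg _

theorem abs_coeff_le_coeffNorm (P : ℝ[X]) (i : ℕ) : |P.coeff i| ≤ coeffNorm P := by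
  by_cases h : i ∈ P.support
  · exact Finset.single_le_sum (f := fun i => |P.coeff i|) (fun _ _ => abs_nonneg _) h
  · rw [notMem_support_iff.1 h, abs_zero]; exact coeffNorm_nonneg P

theorem abs_coeff_mul_le (P H : ℝ[X]) {M : ℝ} (hM : ∀ i, |H.coeff i| ≤ M) (i : ℕ) :
    |(P * H).coeff i| ≤ coeffNorm P * M := by
  have hM0 : 0 ≤ M := (abs_nonneg _).trans (hM 0)
  rw [coeff_mul, Finset.Nat.sum_antidiagonal_eq_sum_range_succ (fun a b => P.coeff a * H.coeff b)]
  calc |∑ k ∈ range (i + 1), P.coeff k * H.coeff (i - k)|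
      ≤ ∑ k ∈ range (i + 1), |P.coeff k| * M := by
        refine (Finset.abs_sum_le_sum_abs _ _).trans (Finset.sum_le_sum fun k _ => ?_)
        rw [abs_mul]
        exact mul_le_mul_of_nonneg_left (hM _) (abs_nonneg _)
    _ = (∑ k ∈ range (i + 1), |P.coeff k|) * M := (Finset.sum_mul ..).symm
    _ ≤ coeffNorm P * M := by
        refine mul_le_mul_of_nonneg_right ?_ hM0
        rw [coeffNorm, Polynomial.sum, ← Finset.sum_filter_add_sum_filter_not (range (i + 1))
          (fun k => k ∈ P.support)]
        rw [Finset.sum_eq_zero (s := (range (i + 1)).filter (fun k => k ∉ P.support)), add_zero]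
        · refine Finset.sum_le_sum_of_subset_of_nonneg ?_ fun _ _ _ => abs_nonneg _
          intro k hk
          exact (Finset.mem_filter.1 hk).2
        · intro k hk
          rw [notMem_support_iff.1 (Finset.mem_filter.1 hk).2, abs_zero]

/-! ### Blocks of layers on which the network is affine -/

theorem width_succ_of_eq_one {d s : ℕ} {m : ℕ → ℕ} {j : ℕ} (h : m (j + 1) = 1) :
    width d s m (j + 1) = width d s m j + s := by
  rw [width, h, Nat.div_one]

/-- If the biases compensate a constant shift `c k` of the input and add a new shift `c (k + 1)`
that makes all pre-activations nonnegative, then the ReLU is inactive and a block of layers only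
multiplies the input polynomial by the filters. -/
theorem layer_affine_block {d s : ℕ} {m : ℕ → ℕ} {J : ℕ} (p : Weights d s m J) (x : Fin d → ℝ)
    (j₀ L : ℕ) (hL : j₀ + L ≤ J) (hm : ∀ k < L, m (j₀ + k + 1) = 1) {P : ℝ[X]}
    (hP : P.natDegree < width d s m j₀) (c : ℕ → ℝ)
    (h0 : ∀ i, layer p x j₀ (by omega) i = P.coeff i + c 0)
    (hb : ∀ k (hk : k < L) (i : Fin (width d s m (j₀ + k + 1))), p.2 ⟨j₀ + k, by omega⟩ i =
      c k * onesResponse p ⟨j₀ + k, by omega⟩ i - c (k + 1))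
    (hc : ∀ k < L, ∀ i,
      0 ≤ ((∏ l ∈ range (k + 1), filterPoly p (j₀ + l)) * P).coeff i + c (k + 1))
    (k : ℕ) (hk : k ≤ L) (j : ℕ) (hj : j = j₀ + k) :
    ((∏ l ∈ range k, filterPoly p (j₀ + l)) * P).natDegree < width d s m j ∧
      ∀ i, layer p x j (by omega) i =
        ((∏ l ∈ range k, filterPoly p (j₀ + l)) * P).coeff i + c k := by
  subst hj
  induction k with
  | zero => simpa using ⟨hP, h0⟩
  | succ k ih =>
    obtain ⟨h1, h2⟩ := ih (by omega)
    have hprod : (∏ l ∈ range (k + 1), filterPoly p (j₀ + l)) * P =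
        filterPoly p (j₀ + k) * ((∏ l ∈ range k, filterPoly p (j₀ + l)) * P) := by
      rw [Finset.prod_range_succ]; ring
    constructor
    · have h3 := natDegree_filterPoly_le p (j₀ + k)
      have h4 := natDegree_mul_le (p := filterPoly p (j₀ + k))
        (q := (∏ l ∈ range k, filterPoly p (j₀ + l)) * P)
      have h5 : width d s m (j₀ + (k + 1)) = width d s m (j₀ + k) + s :=
        width_succ_of_eq_one (hm k (by omega))
      rw [hprod]
      omega
    · intro i
      have h6 := layer_succ_of_eq p x (j := j₀ + k) (by omega) h1 h2 i
      have h7 : ((i : ℕ) + 1) * m (j₀ + k + 1) - 1 = i := by rw [hm k (by omega)]; omega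
      have h8 := hc k (by omega) i
      rw [h7, hb k (by omega), ← hprod] at h6
      refine h6.trans ?_
      rw [max_eq_right (by linarith)]
      ring

/-! ### The deepening rule -/

section Rule

variable {d S n J₁ J₂ J₃ : ℕ}

/-- The product of the first `k` of the filters `F`. -/
noncomputable def partialProd {J : ℕ} (F : Fin J → Fin (2 * S + 1) → ℝ) (k : ℕ) : ℝ[X] :=
  ∏ i ∈ range k, if h : i < J then ofFn (2 * S + 1) (F ⟨i, h⟩) else 1

/-- The position of the component that carries the projection `ξ · x` through the teacher's
layers. It starts at the odd position `1`; each dilated filter moves it by twice the degree of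
the teacher's filter. -/
noncomputable def trackPos (q : Weights d S plain J₂) (k : ℕ) : ℕ :=
  1 + 2 * ∑ i ∈ range k, (filterPoly q i).natDegree

/-- The factor that the projection has picked up after `k` layers of the teacher. -/
noncomputable def trackCoeff (q : Weights d S plain J₂) (k : ℕ) : ℝ :=
  ∏ i ∈ range k, (filterPoly q i).leadingCoeff

/-- The shift of the tracked projection after `k` layers of the teacher, in units of
`β_{J₁}`. It is zero at the start, where the common shift of all components is used instead. -/
noncomputable def trackShift (q : Weights d S plain J₂) (k : ℕ) : ℝ :=
  if k = 0 then 0 else |trackCoeff q k|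

/-- The projection `ξ · x` produced by the filters `u` and the downsampling: the component with
zero-based position `1`, which is the entry `2d - 1` before downsampling. -/
noncomputable def projection (u : Fin J₁ → Fin (2 * S + 1) → ℝ) (x : Fin d → ℝ) : ℝ :=
  (partialProd u J₁ * ofFn d x).coeff (2 * d - 1)

/-- The bias of the teacher at layer `k + 1`, extended by zero. -/
noncomputable def teacherBias (q : Weights d S plain J₂) (k i : ℕ) : ℝ :=
  if h : k < J₂ ∧ i < width d S plain (k + 1) then q.2 ⟨k, h.1⟩ ⟨i, h.2⟩ else 0

/-- The thresholds in the layers that carry the teacher: the even positions have the teacher's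
biases, the tracked position gets a shift that keeps it nonnegative, and at all other odd
positions the threshold is so large that the ReLU vanishes. -/
noncomputable def midThreshold (q : Weights d S plain J₂) (b : ℝ) (k i : ℕ) : ℝ :=
  if i % 2 = 0 then teacherBias q k (i / 2)
  else if i = trackPos q (k + 1) then
    ((filterPoly q k).leadingCoeff * trackShift q k - |trackCoeff q (k + 1)|) * b
  else coeffNorm (filterPoly q k) * (2 * |trackCoeff q k| * b)

/-- The shift that keeps all components nonnegative in the last block of layers. -/
noncomputable def tailShift (F : Fin J₃ → Fin (2 * S + 1) → ℝ) (q : Weights d S plain J₂)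
    (b : ℝ) (k : ℕ) : ℝ :=
  if k = 0 then 0 else coeffNorm (partialProd F k) * ((1 + 2 * |trackCoeff q J₂|) * b)

/-- The thresholds of the last layer, at position `i` of copies of length `K`. The `m`-th copy of the tracked component, for
`m = 3 i + r` with `r = 0, 1, 2`, is cut off at the value of the track at `x^i` plus
`(r - 1) τ`; all other positions have threshold zero. -/
noncomputable def knot (q : Weights d S plain J₂) (D : Sample d n)
    (u : Fin J₁ → Fin (2 * S + 1) → ℝ) (b τ : ℝ) (K i : ℕ) : ℝ :=
  if h : i % K = trackPos q J₂ ∧ i / K / 3 < n then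
    trackCoeff q J₂ * projection u (D ⟨i / K / 3, h.2⟩).1 + |trackCoeff q J₂| * b
      + (((i / K % 3 : ℕ) : ℝ) - 1) * τ
  else 0

/-- The deepening rule for given filters `F` of the last block. The scalar `β_{J₁}` serves as a
bound for the components of the network and `τ` as the half width of the hat functions. -/
noncomputable def deepening (F : Fin J₃ → Fin (2 * S + 1) → ℝ) : DeepeningRule d S n J₁ J₂ J₃ where
  tailFilter := F
  midBias := fun q _ β j i =>
    (if h : (j : ℕ) = J₁ ∧ 0 < J₂ then β (Fin.last J₁) *
        downsample (downAt d J₁ ((j : ℕ) + 1)) (convMatrix (width d (2 * S) (downAt d J₁) j)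
          (dilate (q.1 ⟨0, h.2⟩)) *ᵥ fun _ => (1 : ℝ)) i
      else 0) + midThreshold q (β (Fin.last J₁)) ((j : ℕ) - J₁) i
  tailBias := fun q D u β τ j i =>
    (if h : (j : ℕ) - (J₁ + J₂) < J₃ then
        tailShift F q (β (Fin.last J₁)) ((j : ℕ) - (J₁ + J₂)) *
          downsample (downAt d J₁ ((j : ℕ) + 1)) (convMatrix (width d (2 * S) (downAt d J₁) j)
            (F ⟨(j : ℕ) - (J₁ + J₂), h⟩) *ᵥ fun _ => (1 : ℝ)) i
      else 0) -
    if (j : ℕ) + 1 = J₁ + J₂ + J₃ then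
      -knot q D u (β (Fin.last J₁)) τ (width d (2 * S) (downAt d J₁) (J₁ + J₂)) i
    else tailShift F q (β (Fin.last J₁)) ((j : ℕ) - (J₁ + J₂) + 1)

variable (R : DeepeningRule d S n J₁ J₂ J₃) (F : Fin J₃ → Fin (2 * S + 1) → ℝ)
  (q : Weights d S plain J₂) (D : Sample d n) (u : Fin J₁ → Fin (2 * S + 1) → ℝ)
  (β : Fin (J₁ + 1) → ℝ) (τ : ℝ)

theorem student_fst_head {j : ℕ} (h : j < J₁ + J₂ + J₃) (h₁ : j < J₁) :
    (R.student q D u β τ).1 ⟨j, h⟩ = u ⟨j, h₁⟩ := dif_pos h₁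

theorem student_fst_mid {k : ℕ} (h : J₁ + k < J₁ + J₂ + J₃) (hk : k < J₂) :
    (R.student q D u β τ).1 ⟨J₁ + k, h⟩ = dilate (q.1 ⟨k, hk⟩) := by
  simp [DeepeningRule.student, hk]

theorem student_fst_tail {k : ℕ} (h : J₁ + J₂ + k < J₁ + J₂ + J₃) :
    (R.student q D u β τ).1 ⟨J₁ + J₂ + k, h⟩ = R.tailFilter ⟨k, by omega⟩ := by
  simp [DeepeningRule.student, show ¬ J₁ + J₂ + k < J₁ by omega,
    show ¬ J₁ + J₂ + k < J₁ + J₂ by omega]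

theorem student_snd_head {j : ℕ} (h : j < J₁ + J₂ + J₃) (h₁ : j < J₁)
    (i : Fin (width d (2 * S) (downAt d J₁) (j + 1))) :
    (R.student q D u β τ).2 ⟨j, h⟩ i =
      β ⟨j, by omega⟩ * onesResponse (R.student q D u β τ) ⟨j, h⟩ i - β ⟨j + 1, by omega⟩ := by
  rw [onesResponse, student_fst_head R q D u β τ h h₁]
  simp [DeepeningRule.student, h₁]

theorem student_snd_mid {k : ℕ} (h : J₁ + k < J₁ + J₂ + J₃) (hk : k < J₂)
    (i : Fin (width d (2 * S) (downAt d J₁) (J₁ + k + 1))) :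
    ((deepening F).student q D u β τ).2 ⟨J₁ + k, h⟩ i =
      (if k = 0 then β (Fin.last J₁) else 0) *
          onesResponse ((deepening F).student q D u β τ) ⟨J₁ + k, h⟩ i
        + midThreshold q (β (Fin.last J₁)) k i := by
  rw [onesResponse, student_fst_mid (deepening F) q D u β τ h hk]
  rcases Nat.eq_zero_or_pos k with rfl | hk0
  · simp [DeepeningRule.student, deepening, hk]
  · simp [DeepeningRule.student, deepening, hk, hk0.ne']

theorem student_snd_tail {k : ℕ} (h : J₁ + J₂ + k < J₁ + J₂ + J₃)
    (i : Fin (width d (2 * S) (downAt d J₁) (J₁ + J₂ + k + 1))) :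
    ((deepening F).student q D u β τ).2 ⟨J₁ + J₂ + k, h⟩ i =
      tailShift F q (β (Fin.last J₁)) k *
          onesResponse ((deepening F).student q D u β τ) ⟨J₁ + J₂ + k, h⟩ i
        - if k + 1 = J₃ then
            -knot q D u (β (Fin.last J₁)) τ (width d (2 * S) (downAt d J₁) (J₁ + J₂)) i
          else tailShift F q (β (Fin.last J₁)) (k + 1) := by
  rw [onesResponse, student_fst_tail (deepening F) q D u β τ h]
  have hk : k < J₃ := by omega
  have hk' : J₁ + J₂ + k + 1 = J₁ + J₂ + J₃ ↔ k + 1 = J₃ := by omega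
  simp [DeepeningRule.student, deepening, show ¬ J₁ + J₂ + k < J₁ by omega,
    show ¬ J₁ + J₂ + k < J₁ + J₂ by omega, hk, hk']

theorem filterPoly_student_head {j : ℕ} (h₁ : j < J₁) :
    filterPoly (R.student q D u β τ) j = ofFn (2 * S + 1) (u ⟨j, h₁⟩) := by
  rw [filterPoly_of_lt _ (by omega), student_fst_head]

theorem ofFn_dilate (w : Fin (S + 1) → ℝ) :
    ofFn (2 * S + 1) (dilate w) = expand ℝ 2 (ofFn (S + 1) w) := by
  ext i
  rw [coeff_expand two_pos]
  by_cases hi : i < 2 * S + 1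
  · rw [ofFn_coeff_eq_val_of_lt _ hi, dilate]
    simp only [Nat.dvd_iff_mod_eq_zero]
    split_ifs
    · rw [ofFn_coeff_eq_val_of_lt _ (by omega)]
    · rfl
  · rw [ofFn_coeff_eq_zero_of_ge _ (by omega)]
    split_ifs
    · rw [ofFn_coeff_eq_zero_of_ge _ (by omega)]
    · rfl

theorem filterPoly_student_mid {k : ℕ} (hk : k < J₂) :
    filterPoly (R.student q D u β τ) (J₁ + k) = expand ℝ 2 (filterPoly q k) := by
  rw [filterPoly_of_lt _ (by omega), student_fst_mid _ _ _ _ _ _ _ hk, ofFn_dilate,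
    filterPoly_of_lt _ hk]

theorem filterPoly_student_tail {k : ℕ} (hk : k < J₃) :
    filterPoly (R.student q D u β τ) (J₁ + J₂ + k) =
      ofFn (2 * S + 1) (R.tailFilter ⟨k, hk⟩) := by
  rw [filterPoly_of_lt _ (by omega), student_fst_tail]

theorem prod_filterPoly_student_head {k : ℕ} (hk : k ≤ J₁) :
    ∏ l ∈ range k, filterPoly (R.student q D u β τ) (0 + l) = partialProd u k := by
  refine Finset.prod_congr rfl fun l hl => ?_
  have hl' : l < J₁ := (Finset.mem_range.1 hl).trans_le hk
  rw [zero_add, filterPoly_student_head _ _ _ _ _ _ hl', dif_pos hl']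

theorem partialProd_self {J : ℕ} (F : Fin J → Fin (2 * S + 1) → ℝ) :
    partialProd F J = ∏ j, ofFn (2 * S + 1) (F j) := by
  rw [partialProd, ← Fin.prod_univ_eq_prod_range
    (fun i => if h : i < J then ofFn (2 * S + 1) (F ⟨i, h⟩) else 1)]
  exact Finset.prod_congr rfl fun j _ => dif_pos j.isLt

theorem prod_filterPoly_student_tail {k : ℕ} (hk : k ≤ J₃) :
    ∏ l ∈ range k, filterPoly ((deepening F).student q D u β τ) (J₁ + J₂ + l) = partialProd F k := by
  refine Finset.prod_congr rfl fun l hl => ?_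
  have hl' : l < J₃ := (Finset.mem_range.1 hl).trans_le hk
  rw [filterPoly_student_tail _ _ _ _ _ _ hl', dif_pos hl']
  rfl

end Rule

/-! ### The layers of the deepened network -/

section Layers

variable {d S n J₁ J₂ J₃ : ℕ}

theorem downAt_of_ne {d J₁ j : ℕ} (h : j ≠ J₁) : downAt d J₁ j = 1 := if_neg h

theorem width_downAt_add (d s J₁ k : ℕ) :
    width d s (downAt d J₁) (J₁ + k) = width d s (downAt d J₁) J₁ + k * s := by
  induction k with
  | zero => simp
  | succ k ih =>
    have := width_succ_of_eq_one (d := d) (s := s) (downAt_of_ne (d := d) (J₁ := J₁)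
      (j := J₁ + k + 1) (by omega))
    rw [← add_assoc, this, ih]; ring

theorem width_downAt_of_lt (d s J₁ j : ℕ) (hj : j < J₁) :
    width d s (downAt d J₁) j = d + j * s := by
  induction j with
  | zero => simp [width]
  | succ j ih => rw [width_succ_of_eq_one (downAt_of_ne hj.ne), ih (by omega)]; ring

theorem width_downAt_eq (d s J₁ : ℕ) (h : 1 ≤ J₁) :
    width d s (downAt d J₁) J₁ = (d + J₁ * s) / d := by
  obtain ⟨j, rfl⟩ : ∃ j, J₁ = j + 1 := ⟨J₁ - 1, by omega⟩
  rw [width_downAt_self, width_downAt_of_lt d s (j + 1) j (by omega)]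
  congr 1; ring

theorem natDegree_ofFn_lt {K : ℕ} (hK : 0 < K) (v : Fin K → ℝ) : (ofFn K v).natDegree < K :=
  ofFn_natDegree_lt hK v

/-- The scalars `β` that make the first layers affine: the input is not shifted, and all later
layers are shifted by the constant `B`. -/
def headShifts (J₁ : ℕ) (B : ℝ) : Fin (J₁ + 1) → ℝ := fun j => if j = 0 then 0 else B

/-- The content of the network after `k` layers of the teacher, as a polynomial: the teacher's
`k`-th layer on the even positions and one shifted multiple of `ξ · x` on an odd position. -/
noncomputable def midState (q : Weights d S plain J₂) (u : Fin J₁ → Fin (2 * S + 1) → ℝ) (B : ℝ)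
    (x : Fin d → ℝ) (k : ℕ) (hk : k ≤ J₂) : ℝ[X] :=
  expand ℝ 2 (ofFn (width d S plain k) (layer q x k hk)) +
    C (trackCoeff q k * projection u x + trackShift q k * B) * X ^ trackPos q k

theorem trackPos_odd (q : Weights d S plain J₂) (k : ℕ) : trackPos q k % 2 = 1 := by
  unfold trackPos; omega

theorem trackPos_le (q : Weights d S plain J₂) (k : ℕ) : trackPos q k ≤ 1 + 2 * (k * S) := by
  have : ∑ i ∈ range k, (filterPoly q i).natDegree ≤ ∑ _i ∈ range k, S :=
    Finset.sum_le_sum fun i _ => natDegree_filterPoly_le q i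
  simp only [Finset.sum_const, card_range, smul_eq_mul] at this
  unfold trackPos; omega

theorem trackPos_succ (q : Weights d S plain J₂) (k : ℕ) :
    trackPos q (k + 1) = trackPos q k + 2 * (filterPoly q k).natDegree := by
  unfold trackPos; rw [Finset.sum_range_succ]; ring

theorem trackCoeff_succ (q : Weights d S plain J₂) (k : ℕ) :
    trackCoeff q (k + 1) = (filterPoly q k).leadingCoeff * trackCoeff q k := by
  unfold trackCoeff; rw [Finset.prod_range_succ, mul_comm]

theorem coeff_expand_two_odd (P : ℝ[X]) {i : ℕ} (hi : i % 2 = 1) : (expand ℝ 2 P).coeff i = 0 := by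
  rw [coeff_expand two_pos, if_neg (by omega)]

theorem coeff_expand_two_even (P : ℝ[X]) {i : ℕ} (hi : i % 2 = 0) :
    (expand ℝ 2 P).coeff i = P.coeff (i / 2) := by
  rw [coeff_expand two_pos, if_pos (by omega)]

theorem midState_coeff_even (q : Weights d S plain J₂) (u : Fin J₁ → Fin (2 * S + 1) → ℝ) (B : ℝ)
    (x : Fin d → ℝ) {k : ℕ} (hk : k ≤ J₂) {i : ℕ} (hi : i % 2 = 0) :
    (midState q u B x k hk).coeff i =
      (ofFn (width d S plain k) (layer q x k hk)).coeff (i / 2) := by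
  have := trackPos_odd q k
  rw [midState, coeff_add, coeff_expand_two_even _ hi, coeff_C_mul, coeff_X_pow,
    if_neg (by rintro rfl; omega), mul_zero, add_zero]

theorem midState_coeff_odd (q : Weights d S plain J₂) (u : Fin J₁ → Fin (2 * S + 1) → ℝ) (B : ℝ)
    (x : Fin d → ℝ) {k : ℕ} (hk : k ≤ J₂) {i : ℕ} (hi : i % 2 = 1) :
    (midState q u B x k hk).coeff i = if i = trackPos q k then
      trackCoeff q k * projection u x + trackShift q k * B else 0 := by
  rw [midState, coeff_add, coeff_expand_two_odd _ hi, coeff_C_mul, coeff_X_pow, mul_ite]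
  simp

theorem width_plain_pos (hd : 0 < d) (k : ℕ) : 0 < width d S plain k := by
  rw [width_plain]; omega

theorem natDegree_midState_lt (hd : 0 < d) (q : Weights d S plain J₂)
    (hK : 2 * d ≤ width d (2 * S) (downAt d J₁) J₁)
    (u : Fin J₁ → Fin (2 * S + 1) → ℝ) (B : ℝ) (x : Fin d → ℝ) {k : ℕ} (hk : k ≤ J₂) :
    (midState q u B x k hk).natDegree < width d (2 * S) (downAt d J₁) (J₁ + k) := by
  have h1 := natDegree_ofFn_lt (width_plain_pos hd k) (layer q x k hk)
  have h2 := width_plain d S k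
  have h3 := trackPos_le q k
  have h4 : k * (2 * S) = 2 * (k * S) := by ring
  rw [width_downAt_add, h4]
  refine (natDegree_add_le _ _).trans_lt (max_lt ?_ ?_)
  · rw [natDegree_expand]; omega
  · refine (natDegree_C_mul_le _ _).trans_lt ?_
    rw [natDegree_X_pow]; omega

theorem abs_trackShift_le (q : Weights d S plain J₂) (k : ℕ) :
    |trackShift q k| ≤ |trackCoeff q k| := by
  unfold trackShift; split_ifs <;> simp

theorem abs_track_le (q : Weights d S plain J₂) (k : ℕ) {r B : ℝ} (hr : |r| ≤ B) :
    |trackCoeff q k * r + trackShift q k * B| ≤ 2 * |trackCoeff q k| * B := by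
  have hB : 0 ≤ B := (abs_nonneg r).trans hr
  calc _ ≤ |trackCoeff q k * r| + |trackShift q k * B| := abs_add_le _ _
    _ ≤ |trackCoeff q k| * B + |trackCoeff q k| * B := by
      rw [abs_mul, abs_mul, abs_of_nonneg hB]
      exact add_le_add (mul_le_mul_of_nonneg_left hr (abs_nonneg _))
        (mul_le_mul_of_nonneg_right (abs_trackShift_le q k) hB)
    _ = _ := by ring

/-- One layer of the teacher inside the deepened network. -/
theorem max_midState_succ (hd : 0 < d) (q : Weights d S plain J₂)
    (u : Fin J₁ → Fin (2 * S + 1) → ℝ) {B : ℝ} (x : Fin d → ℝ) (hr : |projection u x| ≤ B)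
    {k : ℕ} (hk : k + 1 ≤ J₂) (i : ℕ) :
    max 0 ((expand ℝ 2 (filterPoly q k) * midState q u B x k (by omega)).coeff i
      - midThreshold q B k i) = (midState q u B x (k + 1) hk).coeff i := by
  have hodd := trackPos_odd q k
  have hB : 0 ≤ B := (abs_nonneg _).trans hr
  set t := trackCoeff q k * projection u x + trackShift q k * B with ht
  have hmul : expand ℝ 2 (filterPoly q k) * midState q u B x k (by omega) =
      expand ℝ 2 (filterPoly q k * ofFn (width d S plain k) (layer q x k (by omega))) +
        C t * (expand ℝ 2 (filterPoly q k) * X ^ trackPos q k) := by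
    rw [midState, map_mul]; ring
  rw [hmul, coeff_add, coeff_C_mul, coeff_mul_X_pow', midThreshold]
  rcases Nat.mod_two_eq_zero_or_one i with hi | hi
  · rw [if_pos hi, midState_coeff_even _ _ _ _ _ hi, coeff_expand_two_even _ hi]
    have h0 : (if trackPos q k ≤ i then (expand ℝ 2 (filterPoly q k)).coeff (i - trackPos q k)
        else 0) = 0 := by
      split_ifs
      · exact coeff_expand_two_odd _ (by omega)
      · rfl
    rw [h0, mul_zero, add_zero]
    have hdeg := natDegree_ofFn_lt (width_plain_pos hd k) (layer q x k (by omega : k ≤ J₂))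
    by_cases hi' : i / 2 < width d S plain (k + 1)
    · rw [ofFn_coeff_eq_val_of_lt _ hi', layer_succ_of_eq q x hk (c := 0) hdeg
        (fun j => by rw [ofFn_coeff_eq_val_of_lt _ j.isLt, add_zero])]
      rw [teacherBias, dif_pos ⟨hk, hi'⟩]
      simp [plain]
    · rw [ofFn_coeff_eq_zero_of_ge _ (by omega), teacherBias, dif_neg (by tauto),
        coeff_eq_zero_of_natDegree_lt, sub_zero, max_self]
      refine natDegree_mul_le.trans_lt ?_
      have := natDegree_filterPoly_le q k
      have h1 := width_plain d S k
      have h2 := width_plain d S (k + 1)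
      rw [add_mul] at h2
      omega
  · rw [if_neg (show ¬ i % 2 = 0 by omega), midState_coeff_odd _ _ _ _ _ hi, coeff_expand_two_odd _ hi, zero_add]
    have htB := abs_track_le q k hr
    by_cases hp : i = trackPos q (k + 1)
    · have h1 : trackPos q k ≤ i := by rw [hp, trackPos_succ]; omega
      have h2 : i - trackPos q k = 2 * (filterPoly q k).natDegree := by
        rw [hp, trackPos_succ]; omega
      rw [if_pos hp, if_pos hp, if_pos h1, h2, coeff_expand_two_even _ (by omega),
        Nat.mul_div_cancel_left _ two_pos, coeff_natDegree]
      have h3 : t * (filterPoly q k).leadingCoeff -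
          ((filterPoly q k).leadingCoeff * trackShift q k - |trackCoeff q (k + 1)|) * B =
          trackCoeff q (k + 1) * projection u x + trackShift q (k + 1) * B := by
        rw [ht, trackShift, trackShift, if_neg (Nat.succ_ne_zero k), trackCoeff_succ]; ring
      rw [h3, max_eq_right]
      rw [trackShift, if_neg (Nat.succ_ne_zero k)]
      have h4 : |trackCoeff q (k + 1) * projection u x| ≤ |trackCoeff q (k + 1)| * B := by
        rw [abs_mul]; gcongr
      linarith [neg_le_of_abs_le h4]
    -- The bias of an odd position off the track is at least what the track can leave there.
    · rw [if_neg hp, if_neg hp, max_eq_left]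
      rw [sub_nonpos]
      refine (le_abs_self _).trans ?_
      rw [abs_mul, mul_comm (coeffNorm _)]
      gcongr
      split_ifs
      · rw [coeff_expand two_pos]
        split_ifs
        · exact abs_coeff_le_coeffNorm _ _
        · rw [abs_zero]; exact coeffNorm_nonneg _
      · rw [abs_zero]; exact coeffNorm_nonneg _

variable (F : Fin J₃ → Fin (2 * S + 1) → ℝ) (q : Weights d S plain J₂) (D : Sample d n)
  (u : Fin J₁ → Fin (2 * S + 1) → ℝ) (B : ℝ) (τ : ℝ)

/-- The filters `u` route the input to the even positions: after downsampling, the input sits on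
the positions `0, 2, …, 2d - 2`, the projection on position `1`, and all else is zero. -/
def Routes (q : Weights d S plain J₂) (u : Fin J₁ → Fin (2 * S + 1) → ℝ) : Prop :=
  ∀ (x : Fin d → ℝ) (B : ℝ) (i : ℕ), i < width d (2 * S) (downAt d J₁) J₁ →
    (partialProd u J₁ * ofFn d x).coeff ((i + 1) * d - 1) =
      (midState q u B x 0 (Nat.zero_le _)).coeff i

theorem layer_head (hd : 0 < d) (hJ₁ : 1 ≤ J₁) (hu : Routes q u) {x : Fin d → ℝ}
    (hB : ∀ k ≤ J₁, ∀ i, |(partialProd u k * ofFn d x).coeff i| ≤ B)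
    (i : Fin (width d (2 * S) (downAt d J₁) J₁)) :
    layer ((deepening F).student q D u (headShifts J₁ B) τ) x J₁ (by omega) i =
      (midState q u B x 0 (Nat.zero_le _)).coeff i + B := by
  set p := (deepening F).student q D u (headShifts J₁ B) τ with hp
  obtain ⟨L, rfl⟩ : ∃ L, J₁ = L + 1 := ⟨J₁ - 1, by omega⟩
  have hblock := layer_affine_block p x 0 L (by omega)
    (fun k hk => downAt_of_ne (by omega)) (P := ofFn d x) (natDegree_ofFn_lt hd x)
    (fun k => if k = 0 then 0 else B)
    (fun i => by
      rw [if_pos rfl, add_zero, ofFn_coeff_eq_val_of_lt x i.isLt, layer]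
      rfl)
    (fun k hk i => by
      rw [student_snd_head (h₁ := by omega)]
      simp [headShifts, Fin.ext_iff, hp])
    (fun k hk i => by
      rw [if_neg (Nat.succ_ne_zero k), hp, prod_filterPoly_student_head _ _ _ _ _ _ (by omega)]
      linarith [neg_le_of_abs_le (hB (k + 1) (by omega) i)]) L le_rfl L (by omega)
  simp only [Nat.zero_add] at hblock
  rw [layer_succ_of_eq p x (j := L) (by omega) hblock.1 hblock.2 i]
  have h2 : filterPoly p L * ((∏ l ∈ range L, filterPoly p l) * ofFn d x) =
      partialProd u (L + 1) * ofFn d x := by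
    rw [← prod_filterPoly_student_head (deepening F) q D u (headShifts (L + 1) B) τ le_rfl,
      Finset.prod_range_succ]
    simp only [Nat.zero_add, ← hp]
    ring
  have h3 : downAt d (L + 1) (L + 1) = d := if_pos rfl
  rw [h2, h3, student_snd_head (h₁ := by omega)]
  have h4 : (if L = 0 then 0 else B) = headShifts (L + 1) B ⟨L, by omega⟩ := by
    simp [headShifts, Fin.ext_iff]
  have h5 : headShifts (L + 1) B ⟨L + 1, by omega⟩ = B := by simp [headShifts, Fin.ext_iff]
  rw [h4, h5, hu x B i i.isLt, max_eq_right]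
  · ring
  · have := hB (L + 1) le_rfl ((i + 1) * d - 1)
    rw [hu x B i i.isLt] at this
    linarith [neg_le_of_abs_le this]

theorem layer_mid (hd : 0 < d) (hJ₁ : 1 ≤ J₁) (hK : 2 * d ≤ width d (2 * S) (downAt d J₁) J₁)
    (hu : Routes q u) {x : Fin d → ℝ}
    (hB : ∀ k ≤ J₁, ∀ i, |(partialProd u k * ofFn d x).coeff i| ≤ B) {k : ℕ} (hk : k ≤ J₂)
    (i : Fin (width d (2 * S) (downAt d J₁) (J₁ + k))) :
    layer ((deepening F).student q D u (headShifts J₁ B) τ) x (J₁ + k) (by omega) i =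
      (midState q u B x k hk).coeff i + if k = 0 then B else 0 := by
  induction k with
  | zero => rw [if_pos rfl]; exact layer_head F q D u B τ hd hJ₁ hu hB i
  | succ k ih =>
    have h1 := layer_succ_of_eq ((deepening F).student q D u (headShifts J₁ B) τ) x
      (j := J₁ + k) (by omega) (natDegree_midState_lt hd q hK u B x (by omega : k ≤ J₂))
      (ih (by omega)) i
    refine h1.trans ?_
    rw [downAt_of_ne (by omega), filterPoly_student_mid _ _ _ _ _ _ hk,
      student_snd_mid (hk := hk), if_neg (Nat.succ_ne_zero k), add_zero,
      ← max_midState_succ hd q u x (hB J₁ le_rfl _) hk]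
    have h2 : headShifts J₁ B (Fin.last J₁) = B := by simp [headShifts, Fin.ext_iff]; omega
    rw [h2]
    congr 1
    have h3 : ((i : ℕ) + 1) * 1 - 1 = i := by omega
    rw [h3]
    ring

/-- The last layer: the filters of the last block convolve the teacher's last layer and the track,
and the knots are subtracted before the last ReLU. -/
theorem layer_last (hd : 0 < d) (hJ₁ : 1 ≤ J₁) (hJ₂ : 1 ≤ J₂) (hJ₃ : 1 ≤ J₃)
    (hK : 2 * d ≤ width d (2 * S) (downAt d J₁) J₁)
    (hu : Routes q u) {x : Fin d → ℝ}
    (hB : ∀ k ≤ J₁, ∀ i, |(partialProd u k * ofFn d x).coeff i| ≤ B)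
    (hT : ∀ i, |layer q x J₂ le_rfl i| ≤ B)
    (i : Fin (width d (2 * S) (downAt d J₁) (J₁ + J₂ + J₃))) :
    layer ((deepening F).student q D u (headShifts J₁ B) τ) x (J₁ + J₂ + J₃) le_rfl i =
      max 0 ((partialProd F J₃ * midState q u B x J₂ le_rfl).coeff i
        - knot q D u B τ (width d (2 * S) (downAt d J₁) (J₁ + J₂)) i) := by
  have hlast : headShifts J₁ B (Fin.last J₁) = B := by simp [headShifts, Fin.ext_iff]; omega
  have hB0 : 0 ≤ B := (abs_nonneg _).trans (hB 0 (Nat.zero_le _) 0)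
  obtain ⟨L, rfl⟩ : ∃ L, J₃ = L + 1 := ⟨J₃ - 1, by omega⟩
  set p := (deepening F).student q D u (headShifts J₁ B) τ with hp
  have hH : ∀ i, |(midState q u B x J₂ le_rfl).coeff i| ≤ (1 + 2 * |trackCoeff q J₂|) * B := by
    intro i
    have h0 : 0 ≤ 2 * |trackCoeff q J₂| * B := by positivity
    rcases Nat.mod_two_eq_zero_or_one i with hi | hi
    · rw [midState_coeff_even _ _ _ _ _ hi]
      by_cases hi' : i / 2 < width d S plain J₂
      · rw [ofFn_coeff_eq_val_of_lt _ hi']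
        linarith [hT ⟨i / 2, hi'⟩]
      · rw [ofFn_coeff_eq_zero_of_ge _ (by omega), abs_zero]; linarith
    · rw [midState_coeff_odd _ _ _ _ _ hi]
      split_ifs
      · have hr : |projection u x| ≤ B := hB J₁ le_rfl (2 * d - 1)
        linarith [abs_track_le q J₂ hr]
      · rw [abs_zero]; linarith
  have hblock := layer_affine_block p x (J₁ + J₂) L (by omega)
    (fun k hk => downAt_of_ne (by omega)) (natDegree_midState_lt hd q hK u B x le_rfl)
    (fun k => tailShift F q B k)
    (fun i => by
      have h := layer_mid F q D u B τ hd hJ₁ hK hu hB le_rfl i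
      rw [if_neg (by omega)] at h
      simpa [tailShift] using h)
    (fun k hk i => by
      rw [student_snd_tail, if_neg (by omega), hlast])
    (fun k hk i => by
      rw [hp, prod_filterPoly_student_tail _ _ _ _ _ _ (by omega), tailShift,
        if_neg (Nat.succ_ne_zero k)]
      linarith [neg_le_of_abs_le (abs_coeff_mul_le (partialProd F (k + 1)) _ hH i)])
    L le_rfl _ rfl
  have h1 := layer_succ_of_eq p x (j := J₁ + J₂ + L) (by omega) hblock.1 hblock.2 i
  refine h1.trans ?_
  have h2 : filterPoly p (J₁ + J₂ + L) * ((∏ l ∈ range L, filterPoly p (J₁ + J₂ + l)) *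
      midState q u B x J₂ le_rfl) =
      partialProd F (L + 1) * midState q u B x J₂ le_rfl := by
    rw [← prod_filterPoly_student_tail F q D u (headShifts J₁ B) τ le_rfl,
      Finset.prod_range_succ, ← hp]
    ring
  have h3 : ((i : ℕ) + 1) * 1 - 1 = i := by omega
  rw [h2, downAt_of_ne (by omega), student_snd_tail, if_pos rfl, hlast, h3]
  congr 1
  ring

end Layers

/-! ### The choice of the filters -/

section Filters

variable {d S n J₁ J₂ J₃ : ℕ}

theorem exists_partialProd_eq {J : ℕ} (hJ : 1 ≤ J) (P : ℝ[X]) (hP : P.natDegree ≤ 2 * S * J) :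
    ∃ u : Fin J → Fin (2 * S + 1) → ℝ, partialProd u J = P := by
  obtain ⟨L, rfl⟩ : ∃ L, J = L + 1 := ⟨J - 1, by omega⟩
  obtain ⟨u, hu⟩ := exists_prod_ofFn_eq S L P hP
  exact ⟨u, by rw [partialProd_self, hu]⟩

/-- There are filters whose joint effect is to put `N` copies of a vector of length `K` next to
each other. -/
theorem exists_copy_filters {N K J : ℕ} (hJ : 1 ≤ J) (h : (N - 1) * K ≤ 2 * S * J) :
    ∃ F : Fin J → Fin (2 * S + 1) → ℝ, partialProd F J = ∑ m ∈ range N, X ^ (m * K) := by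
  refine exists_partialProd_eq hJ _ (natDegree_sum_le_of_forall_le _ _ fun m hm => ?_)
  rw [natDegree_X_pow]
  exact (Nat.mul_le_mul_right K (by have := Finset.mem_range.1 hm; omega)).trans h

theorem coeff_copies_mul {N K m r : ℕ} {H : ℝ[X]} (hH : H.natDegree < K) (hm : m < N)
    (hr : r < K) :
    ((∑ m ∈ range N, X ^ (m * K)) * H).coeff (m * K + r) = H.coeff r := by
  rw [Finset.sum_mul, finsetSum_coeff, Finset.sum_eq_single m]
  · rw [coeff_X_pow_mul', if_pos (by omega), Nat.add_sub_cancel_left]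
  · intro l _ hl
    rw [coeff_X_pow_mul']
    split_ifs with hle
    · refine coeff_eq_zero_of_natDegree_lt ?_
      rcases lt_or_gt_of_ne hl with h | h
      · have := Nat.mul_le_mul_right K (show l + 1 ≤ m from h)
        rw [add_mul] at this; omega
      · have := Nat.mul_le_mul_right K (show m + 1 ≤ l from h)
        rw [add_mul] at this; omega
    · rfl
  · exact fun h => absurd (Finset.mem_range.2 hm) h

/-- Every linear functional `x ↦ ξ · x` is the projection belonging to some routing filters. Row
`i` of the matrix that acts after the downsampling occupies its own block of `d` coefficients of
the product of the filters, so that all its rows can be prescribed. -/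
theorem exists_routing (hd : 0 < d) (hJ₁ : 1 ≤ J₁) (h : 2 * d * d ≤ 2 * S * J₁) (ξ : Fin d → ℝ) :
    ∃ u : Fin J₁ → Fin (2 * S + 1) → ℝ, (∀ q : Weights d S plain J₂, Routes q u) ∧
      ∀ x, projection u x = ξ ⬝ᵥ x := by
  -- The matrix wanted after the downsampling; its rows with index `2d` or more vanish.
  let row : ℕ → ℕ → ℝ := fun i k =>
    if i % 2 = 0 then if i / 2 = k then 1 else 0 else if i = 1 then (ofFn d ξ).coeff k else 0
  -- A convolution reverses the order of the entries within a block.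
  let W : ℝ[X] := ofFn (2 * d * d) fun n => row ((n : ℕ) / d) (d - 1 - (n : ℕ) % d)
  have hW : ∀ i k, k < d → W.coeff (i * d + (d - 1 - k)) = row i k := by
    intro i k hk
    have h1 : (i * d + (d - 1 - k)) / d = i := by
      rw [mul_comm, Nat.mul_add_div hd, Nat.div_eq_of_lt (by omega), add_zero]
    have h2 : (i * d + (d - 1 - k)) % d = d - 1 - k := by
      rw [mul_comm, Nat.mul_add_mod, Nat.mod_eq_of_lt (by omega)]
    by_cases hi : i < 2 * d
    · have h3 := Nat.mul_le_mul_right d (show i + 1 ≤ 2 * d from hi)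
      rw [add_mul] at h3
      rw [ofFn_coeff_eq_val_of_lt _ (by omega)]
      simp only [h1, h2]
      congr 1; omega
    · have h3 := Nat.mul_le_mul_right d (show 2 * d ≤ i by omega)
      rw [ofFn_coeff_eq_zero_of_ge _ (by omega)]
      simp only [row]
      split_ifs <;> first | rfl | omega
  obtain ⟨u, hu⟩ := exists_partialProd_eq (S := S) hJ₁ W
    ((natDegree_ofFn_lt (by positivity) _).le.trans h)
  have hrow : ∀ (x : Fin d → ℝ) i, (partialProd u J₁ * ofFn d x).coeff ((i + 1) * d - 1) =
      ∑ k ∈ range d, (ofFn d x).coeff k * row i k := by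
    intro x i
    have h1 : d ≤ (i + 1) * d := Nat.le_mul_of_pos_left d (by omega)
    rw [hu, mul_comm, coeff_mul, Finset.Nat.sum_antidiagonal_eq_sum_range_succ
      (fun a b => (ofFn d x).coeff a * W.coeff b),
      ← Finset.sum_subset (s₁ := range d) (range_subset_range.2 (by omega))]
    · refine Finset.sum_congr rfl fun k hk => ?_
      rw [← hW i k (Finset.mem_range.1 hk)]
      congr 2
      have := Finset.mem_range.1 hk
      rw [add_mul]; omega
    · intro k _ hk
      rw [ofFn_coeff_eq_zero_of_ge _ (by simpa using hk), zero_mul]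
  have hproj : ∀ x, projection u x = ξ ⬝ᵥ x := by
    intro x
    have := hrow x 1
    simp only [row, Nat.one_mod, one_ne_zero, if_false, if_true] at this
    rw [projection, show 2 * d - 1 = (1 + 1) * d - 1 by ring_nf, this,
      ← Fin.sum_univ_eq_sum_range (fun k => (ofFn d x).coeff k * (ofFn d ξ).coeff k)]
    refine Finset.sum_congr rfl fun k _ => ?_
    rw [ofFn_coeff_eq_val_of_lt _ k.isLt, ofFn_coeff_eq_val_of_lt _ k.isLt, mul_comm]
  refine ⟨u, fun q x B i _ => ?_, hproj⟩
  rw [hrow]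
  rcases Nat.mod_two_eq_zero_or_one i with hi | hi
  · rw [midState_coeff_even _ _ _ _ _ hi]
    simp only [row, if_pos hi, mul_ite, mul_one, mul_zero, Finset.sum_ite_eq, Finset.mem_range]
    split_ifs with h2
    · rfl
    · exact (ofFn_coeff_eq_zero_of_ge _ (not_lt.1 h2)).symm
  · have h0 : ¬ i % 2 = 0 := by omega
    rw [midState_coeff_odd _ _ _ _ _ hi]
    by_cases h1 : i = 1
    · have h2 : projection u x = ∑ k ∈ range d, (ofFn d x).coeff k * row 1 k := by
        rw [← hrow, projection]
      simp [h1, trackPos, trackCoeff, trackShift, h2]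
    · simp [row, h0, h1, trackPos]

end Filters

/-! ### Output functions of the deepened network -/

section Outputs

variable {d S n J₁ J₂ J₃ : ℕ}

/-- The hat function with peak `1` at `0` and support `[-τ, τ]`, as a combination of three
ReLUs. -/
noncomputable def hat (τ t : ℝ) : ℝ :=
  (max 0 (t + τ) - 2 * max 0 t + max 0 (t - τ)) / τ

theorem hat_zero {τ : ℝ} (hτ : 0 < τ) : hat τ 0 = 1 := by
  rw [hat, max_eq_right (by linarith), max_self, max_eq_left (by linarith)]
  field_simp; ring

theorem hat_eq_zero {τ t : ℝ} (hτ : 0 < τ) (ht : τ ≤ |t|) : hat τ t = 0 := by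
  rw [hat]
  rcases le_abs.1 ht with h | h
  · rw [max_eq_right (by linarith), max_eq_right (by linarith), max_eq_right (by linarith)]
    ring
  · rw [max_eq_left (by linarith), max_eq_left (by linarith), max_eq_left (by linarith)]
    ring

theorem exists_dotProduct_eq_sum {ι : Type*} [Fintype ι] {K : ℕ} (pos : ι → Fin K) (a : ι → ℝ) :
    ∃ c : Fin K → ℝ, ∀ h : Fin K → ℝ, c ⬝ᵥ h = ∑ i, a i * h (pos i) := by
  refine ⟨∑ i, Pi.single (pos i) (a i), fun h => ?_⟩
  rw [sum_dotProduct]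
  simp

variable (F : Fin J₃ → Fin (2 * S + 1) → ℝ) (q : Weights d S plain J₂) (D : Sample d n)
  (u : Fin J₁ → Fin (2 * S + 1) → ℝ) {B : ℝ} (τ : ℝ)

/-- Every output function of the teacher plus a combination of hat functions of `ξ · x`, centred
at the data, is an output function of the deepened network, on every set on which `B` bounds the
affine layers and the last layer of the teacher. -/
theorem exists_output_student {N : ℕ} (hd : 0 < d) (hJ₁ : 1 ≤ J₁) (hJ₂ : 1 ≤ J₂) (hJ₃ : 1 ≤ J₃)
    (hK : 2 * d ≤ width d (2 * S) (downAt d J₁) J₁) (hu : Routes q u)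
    (hN : 3 * n ≤ N) (hN1 : 1 ≤ N)
    (hJN : (N - 1) * width d (2 * S) (downAt d J₁) (J₁ + J₂) ≤ 2 * S * J₃)
    (hF : partialProd F J₃ = ∑ m ∈ range N, X ^ (m * width d (2 * S) (downAt d J₁) (J₁ + J₂)))
    (c : Fin (width d S plain J₂) → ℝ) (a : ℝ) (e : Fin n → ℝ) :
    ∃ f ∈ outputs ((deepening F).student q D u (headShifts J₁ B) τ), ∀ x : Fin d → ℝ,
      (∀ k ≤ J₁, ∀ i, |(partialProd u k * ofFn d x).coeff i| ≤ B) →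
      (∀ i, |layer q x J₂ le_rfl i| ≤ B) →
      f x = c ⬝ᵥ layer q x J₂ le_rfl + a +
        ∑ i, e i * hat τ (trackCoeff q J₂ * (projection u x - projection u (D i).1)) := by
  set K := width d (2 * S) (downAt d J₁) (J₁ + J₂) with hKdef
  have hKeq : K = width d (2 * S) (downAt d J₁) J₁ + J₂ * (2 * S) := width_downAt_add ..
  have hwid : width d (2 * S) (downAt d J₁) (J₁ + J₂ + J₃) = K + 2 * S * J₃ := by
    rw [add_assoc, width_downAt_add, hKeq]; ring
  have hNK : N * K ≤ width d (2 * S) (downAt d J₁) (J₁ + J₂ + J₃) := by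
    have : N * K = (N - 1) * K + K := by
      obtain ⟨N', rfl⟩ : ∃ N', N = N' + 1 := ⟨N - 1, by omega⟩
      simp [add_mul]
    omega
  have hSJ : J₂ * (2 * S) = 2 * (J₂ * S) := by ring
  have hwq := width_plain d S J₂
  have hp := trackPos_le q J₂
  have hp1 := trackPos_odd q J₂
  have hpos1 : ∀ k : Fin (width d S plain J₂), 2 * (k : ℕ) < K := fun k => by
    have := k.isLt; omega
  have hpK : trackPos q J₂ < K := by omega
  have hpos : ∀ m r, m < N → r < K → m * K + r < width d (2 * S) (downAt d J₁) (J₁ + J₂ + J₃) := by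
    intro m r hm hr
    have := Nat.mul_le_mul_right K (show m + 1 ≤ N from hm)
    rw [add_mul] at this; omega
  obtain ⟨c₁, hc₁⟩ := exists_dotProduct_eq_sum (fun k : Fin (width d S plain J₂) =>
    (⟨2 * k, by have := hpos 0 _ hN1 (hpos1 k); omega⟩ :
      Fin (width d (2 * S) (downAt d J₁) (J₁ + J₂ + J₃)))) c
  have hpos2 : ∀ (i : Fin n) (r : Fin 3), (3 * (i : ℕ) + r) * K + trackPos q J₂ <
      width d (2 * S) (downAt d J₁) (J₁ + J₂ + J₃) := fun i r =>
    hpos _ _ (by have := i.isLt; have := r.isLt; omega) hpK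
  obtain ⟨c₂, hc₂⟩ := exists_dotProduct_eq_sum (fun ir : Fin n × Fin 3 =>
    (⟨_, hpos2 ir.1 ir.2⟩ : Fin (width d (2 * S) (downAt d J₁) (J₁ + J₂ + J₃))))
    (fun ir => e ir.1 / τ * ![1, -2, 1] ir.2)
  refine ⟨_, ⟨c₁ + c₂, a, rfl⟩, fun x hB hT => ?_⟩
  have hlast := layer_last F q D u B τ hd hJ₁ hJ₂ hJ₃ hK hu hB hT
  have hdeg : (midState q u B x J₂ le_rfl).natDegree < K := natDegree_midState_lt hd q hK u B x le_rfl
  have hA : ∀ k : Fin (width d S plain J₂), ∀ hk,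
      layer ((deepening F).student q D u (headShifts J₁ B) τ) x (J₁ + J₂ + J₃) le_rfl
        ⟨2 * k, hk⟩ = layer q x J₂ le_rfl k := by
    intro k hk
    have h1 := coeff_copies_mul hdeg (show 0 < N by omega) (hpos1 k)
    have h2 : knot q D u B τ K (2 * k) = 0 := by
      rw [knot, dif_neg]
      rintro ⟨h, -⟩
      rw [Nat.mod_eq_of_lt (hpos1 k)] at h
      omega
    rw [zero_mul, zero_add] at h1
    rw [hlast, hF, h1, ← hKdef, h2, midState_coeff_even _ _ _ _ _ (by omega), sub_zero,
      Nat.mul_div_cancel_left _ two_pos, ofFn_coeff_eq_val_of_lt _ k.isLt, max_eq_right]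
    obtain ⟨j, rfl⟩ : ∃ j, J₂ = j + 1 := ⟨J₂ - 1, by omega⟩
    exact le_max_left _ _
  have hC : ∀ (i : Fin n) (r : Fin 3),
      layer ((deepening F).student q D u (headShifts J₁ B) τ) x (J₁ + J₂ + J₃) le_rfl
        ⟨_, hpos2 i r⟩ =
      max 0 (trackCoeff q J₂ * (projection u x - projection u (D i).1) - (((r : ℕ) : ℝ) - 1) * τ) := by
    intro i r
    have hi := i.isLt
    have hr := r.isLt
    have h1 := coeff_copies_mul hdeg (show 3 * (i : ℕ) + r < N by omega) hpK
    have hmod : ((3 * (i : ℕ) + r) * K + trackPos q J₂) % K = trackPos q J₂ := by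
      rw [mul_comm, Nat.mul_add_mod, Nat.mod_eq_of_lt hpK]
    have hdiv : ((3 * (i : ℕ) + r) * K + trackPos q J₂) / K = 3 * (i : ℕ) + r := by
      rw [mul_comm, Nat.mul_add_div (by omega), Nat.div_eq_of_lt hpK, add_zero]
    have hdiv3 : (3 * (i : ℕ) + r) / 3 = i := by omega
    have hmod3 : (3 * (i : ℕ) + r) % 3 = r := by omega
    rw [hlast, hF, h1, ← hKdef, midState_coeff_odd _ _ _ _ _ hp1, if_pos rfl, knot,
      dif_pos ⟨hmod, by rw [hdiv, hdiv3]; exact hi⟩, trackShift, if_neg (by omega)]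
    simp only [hdiv, hdiv3, hmod3]
    congr 1
    ring
  simp only [add_dotProduct, hc₁, hc₂, hA, hC, Fintype.sum_prod_type, Fin.sum_univ_three]
  rw [add_assoc, add_assoc, add_comm _ a]
  congr 2
  refine Finset.sum_congr rfl fun i _ => ?_
  simp only [hat, Matrix.cons_val_zero, Matrix.cons_val_one, Matrix.cons_val_two,
    Matrix.head_cons, Matrix.tail_cons, Fin.val_zero, Fin.val_one, Fin.val_two]
  norm_num
  ring_nf

end Outputs

/-! ### Counting the free parameters -/

section Parameters

theorem HasFreeParameters.of_finrank {W Θ : Type*} [PseudoEMetricSpace W] [NormedAddCommGroup Θ]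
    [NormedSpace ℝ Θ] [FiniteDimensional ℝ Θ] {k : ℕ} (hk : Module.finrank ℝ Θ = k) (Ψ : Θ → W)
    (hΨ : LocallyLipschitz Ψ) {U : Set Θ} (hU : IsOpen U) (hUd : Dense U) (hinj : Set.InjOn Ψ U) :
    HasFreeParameters (Set.range Ψ) k := by
  let e : (Fin k → ℝ) ≃L[ℝ] Θ := ContinuousLinearEquiv.ofFinrankEq (by simp [hk])
  refine ⟨Ψ ∘ e, hΨ.comp e.toContinuousLinearMap.lipschitz.locallyLipschitz,
    e.surjective.range_comp Ψ, e ⁻¹' U, hU.preimage e.continuous,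
    hUd.preimage e.toHomeomorph.isOpenMap, ?_⟩
  intro a ha b hb hab
  exact e.injective (hinj ha hb hab)

variable {d S n J₁ J₂ J₃ : ℕ}

theorem contDiff_coeff_partialProd {J : ℕ} (k i : ℕ) :
    ContDiff ℝ 1 fun u : Fin J → Fin (2 * S + 1) → ℝ => (partialProd u k).coeff i := by
  induction k generalizing i with
  | zero => simp only [partialProd, Finset.range_zero, Finset.prod_empty]; exact contDiff_const
  | succ k ih =>
    have h : ∀ i, ContDiff ℝ 1 fun u : Fin J → Fin (2 * S + 1) → ℝ =>
        (if h : k < J then ofFn (2 * S + 1) (u ⟨k, h⟩) else 1 : ℝ[X]).coeff i := by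
      intro i
      split_ifs with hk
      · by_cases hi : i < 2 * S + 1
        · simp only [ofFn_coeff_eq_val_of_lt _ hi]; fun_prop
        · simp only [ofFn_coeff_eq_zero_of_ge _ (not_lt.1 hi)]; exact contDiff_const
      · exact contDiff_const
    have h2 : (fun u : Fin J → Fin (2 * S + 1) → ℝ => (partialProd u (k + 1)).coeff i) =
        fun u => ∑ x ∈ antidiagonal i, (partialProd u k).coeff x.1 *
          (if h : k < J then ofFn (2 * S + 1) (u ⟨k, h⟩) else 1 : ℝ[X]).coeff x.2 := by
      funext u
      rw [partialProd, Finset.prod_range_succ, coeff_mul]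
      rfl
    rw [h2]
    exact ContDiff.sum fun x _ => (ih x.1).mul (h x.2)

theorem contDiff_projection (x : Fin d → ℝ) :
    ContDiff ℝ 1 fun u : Fin J₁ → Fin (2 * S + 1) → ℝ => projection u x := by
  simp only [projection, coeff_mul]
  exact ContDiff.sum fun y _ => (contDiff_coeff_partialProd _ _).mul contDiff_const

/-- The free parameters of a deepened network: filters, shifts, the width of the hats, and the
output coefficients. -/
abbrev ParameterSpace (S J₁ w : ℕ) : Type :=
  (Fin J₁ → Fin (2 * S + 1) → ℝ) × (Fin (J₁ + 1) → ℝ) × ℝ × (Fin w → ℝ) × ℝ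

theorem finrank_parameterSpace (S J₁ w : ℕ) :
    Module.finrank ℝ (ParameterSpace S J₁ w) = w + J₁ * (2 * S + 2) + 3 := by
  simp only [ParameterSpace, Module.finrank_prod, Module.finrank_pi, Module.finrank_pi_fintype,
    Module.finrank_self, Fintype.card_fin, Finset.sum_const, Finset.card_univ, smul_eq_mul]
  ring

variable (F : Fin J₃ → Fin (2 * S + 1) → ℝ) (q : Weights d S plain J₂) (D : Sample d n)

/-- The network with given free parameters. -/
noncomputable def parametrization
    (θ : ParameterSpace S J₁ (width d (2 * S) (downAt d J₁) (J₁ + J₂ + J₃))) :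
    Weights d (2 * S) (downAt d J₁) (J₁ + J₂ + J₃) ×
      (Fin (width d (2 * S) (downAt d J₁) (J₁ + J₂ + J₃)) → ℝ) × ℝ :=
  ((deepening F).student q D θ.1 θ.2.1 θ.2.2.1, θ.2.2.2.1, θ.2.2.2.2)

theorem range_parametrization :
    Set.range (parametrization (J₁ := J₁) F q D) = (deepening F).family q D := by
  ext t
  constructor
  · rintro ⟨θ, rfl⟩
    exact ⟨θ.1, θ.2.1, θ.2.2.1, rfl⟩
  · rintro ⟨u, β, τ, h⟩
    exact ⟨(u, β, τ, t.2.1, t.2.2), by rw [parametrization, ← h]⟩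

theorem contDiff_student : ContDiff ℝ 1
    fun θ : (Fin J₁ → Fin (2 * S + 1) → ℝ) × (Fin (J₁ + 1) → ℝ) × ℝ =>
      (deepening F).student q D θ.1 θ.2.1 θ.2.2 := by
  have hproj : ∀ x : Fin d → ℝ, ContDiff ℝ 1
      fun θ : (Fin J₁ → Fin (2 * S + 1) → ℝ) × (Fin (J₁ + 1) → ℝ) × ℝ => projection θ.1 x :=
    fun x => (contDiff_projection x).comp contDiff_fst
  have hb : ContDiff ℝ 1
      fun θ : (Fin J₁ → Fin (2 * S + 1) → ℝ) × (Fin (J₁ + 1) → ℝ) × ℝ =>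
        θ.2.1 (Fin.last J₁) := by fun_prop
  have hshift : ∀ k, ContDiff ℝ 1
      fun θ : (Fin J₁ → Fin (2 * S + 1) → ℝ) × (Fin (J₁ + 1) → ℝ) × ℝ =>
        tailShift F q (θ.2.1 (Fin.last J₁)) k := by
    intro k
    unfold tailShift
    split_ifs
    · exact contDiff_const
    · fun_prop
  refine ContDiff.prodMk (contDiff_pi.2 fun j => ?_) (contDiff_pi.2 fun j => contDiff_pi.2 fun i => ?_)
  · split_ifs
    · fun_prop
    · exact contDiff_const
    · exact contDiff_const
  · split_ifs with h₁ h₂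
    · simp only [downsample, Matrix.mulVec, dotProduct, convMatrix, Matrix.of_apply, mul_one]
      refine ContDiff.sub (ContDiff.mul (by fun_prop) (ContDiff.sum fun k _ => ?_)) (by fun_prop)
      split_ifs
      · fun_prop
      · exact contDiff_const
    · simp only [deepening]
      refine ContDiff.add ?_ ?_
      · split_ifs
        · fun_prop
        · exact contDiff_const
      · unfold midThreshold
        split_ifs
        · exact contDiff_const
        · fun_prop
        · fun_prop
    · simp only [deepening]
      refine ContDiff.sub ?_ ?_
      · split_ifs
        · exact (hshift _).mul contDiff_const
        · exact contDiff_const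
      · split_ifs
        · refine ContDiff.neg ?_
          unfold knot
          split_ifs
          · exact ((contDiff_const.mul (hproj _)).add (by fun_prop)).add (by fun_prop)
          · exact contDiff_const
        · exact hshift _

theorem contDiff_parametrization : ContDiff ℝ 1 (parametrization (J₁ := J₁) F q D) := by
  have h : ContDiff ℝ 1 fun θ : ParameterSpace S J₁
      (width d (2 * S) (downAt d J₁) (J₁ + J₂ + J₃)) => (θ.1, θ.2.1, θ.2.2.1) := by fun_prop
  exact ((contDiff_student F q D).comp h).prodMk (by fun_prop)

theorem onesResponse_first {m : ℕ → ℕ} {J : ℕ} {s : ℕ} (p : Weights d s m J) (hd : 2 ≤ d)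
    (hs : 1 ≤ s) (hm : m 1 = 1) (hJ : 0 < J) (h0 : 0 < width d s m 1) (h1 : 1 < width d s m 1) :
    onesResponse p ⟨0, hJ⟩ ⟨1, h1⟩ - onesResponse p ⟨0, hJ⟩ ⟨0, h0⟩ =
      p.1 ⟨0, hJ⟩ ⟨1, by omega⟩ := by
  have hone : (fun _ => (1 : ℝ) : Fin (width d s m 0) → ℝ) =
      fun k : Fin (width d s m 0) => (ofFn d fun _ => (1 : ℝ)).coeff k := by
    funext k
    rw [ofFn_coeff_eq_val_of_lt _ (show (k : ℕ) < d from k.isLt)]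
  have hdeg : (ofFn d fun _ => (1 : ℝ)).natDegree < width d s m 0 :=
    natDegree_ofFn_lt (by omega) _
  simp only [onesResponse, downsample, hone, convMatrix_mulVec_coeff _ _ hdeg, zero_add, hm,
    Nat.mul_one, Nat.sub_self, Nat.reduceAdd, Nat.reduceSub, mul_coeff_zero, mul_coeff_one]
  rw [ofFn_coeff_eq_val_of_lt _ (show 0 < d by omega),
    ofFn_coeff_eq_val_of_lt _ (show 1 < d by omega),
    ofFn_coeff_eq_val_of_lt _ (show 1 < s + 1 by omega)]
  ring

/-- The filters are part of the network. The first layer determines `β₀` and `β₁` if its filter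
has a nonzero second entry, as two of its biases then depend on `β₀` differently; the further
shifts follow one by one, and `τ` enters a knot of the last layer with coefficient one. -/
theorem injOn_parametrization (hd : 2 ≤ d) (hS : 1 ≤ S) (hn : 1 ≤ n) (hJ₁ : 2 ≤ J₁)
    (hJ₂ : 1 ≤ J₂) (hJ₃ : 1 ≤ J₃)
    (hK : 2 * d ≤ width d (2 * S) (downAt d J₁) J₁)
    (hw : 3 * width d (2 * S) (downAt d J₁) (J₁ + J₂) ≤
      width d (2 * S) (downAt d J₁) (J₁ + J₂ + J₃)) :
    Set.InjOn (parametrization (J₁ := J₁) F q D)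
      {θ | θ.1 ⟨0, by omega⟩ ⟨1, by omega⟩ ≠ 0} := by
  rintro ⟨u, β, τ, c, a⟩ hθ ⟨u', β', τ', c', a'⟩ - h
  simp only [parametrization, Prod.mk.injEq] at h
  obtain ⟨hp, rfl, rfl⟩ := h
  simp only [Set.mem_ofPred_eq] at hθ
  have hu : u = u' := by
    funext j
    rw [← student_fst_head (deepening F) q D u β τ (by omega) j.isLt, hp, student_fst_head]
  subst hu
  have hwpos : ∀ j, 0 < width d (2 * S) (downAt d J₁) j := by
    intro j
    rcases lt_or_ge j J₁ with hj | hj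
    · rw [width_downAt_of_lt _ _ _ _ hj]; omega
    · obtain ⟨k, rfl⟩ := Nat.exists_eq_add_of_le hj
      rw [width_downAt_add]; omega
  have hw1 : 1 < width d (2 * S) (downAt d J₁) (0 + 1) := by
    rw [width_downAt_of_lt _ _ _ _ (by omega)]; omega
  have hbias : ∀ (j : ℕ) (hj : j < J₁) (i : Fin (width d (2 * S) (downAt d J₁) (j + 1))),
      β ⟨j, by omega⟩ * onesResponse ((deepening F).student q D u β τ) ⟨j, by omega⟩ i -
          β ⟨j + 1, by omega⟩ =
        β' ⟨j, by omega⟩ * onesResponse ((deepening F).student q D u β τ) ⟨j, by omega⟩ i -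
          β' ⟨j + 1, by omega⟩ := by
    intro j hj i
    rw [← student_snd_head (deepening F) q D u β τ (by omega) hj, hp, ← student_snd_head _ _ _ _ _ _ _ hj]
  have hβ : ∀ (j : ℕ) (hj : j < J₁ + 1), β ⟨j, hj⟩ = β' ⟨j, hj⟩ := by
    intro j
    induction j with
    | zero =>
      intro _
      have h0 := hbias 0 (by omega) ⟨0, hwpos _⟩
      have h1 := hbias 0 (by omega) ⟨1, hw1⟩
      have h2 := onesResponse_first ((deepening F).student q D u β τ) hd (by omega)
        (downAt_of_ne (by omega)) (by omega) (hwpos _) hw1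
      rw [student_fst_head (deepening F) q D u β τ (by omega) (show 0 < J₁ by omega)] at h2
      rw [← h2] at hθ
      refine mul_right_cancel₀ hθ ?_
      linarith
    | succ j ih =>
      intro hj
      have h0 := hbias j (by omega) ⟨0, hwpos _⟩
      rw [ih (by omega)] at h0
      linarith
  have hβ' : β = β' := funext fun j => hβ j j.isLt
  subst hβ'
  set K := width d (2 * S) (downAt d J₁) (J₁ + J₂) with hKdef
  have hpK : trackPos q J₂ < K := by
    have h1 := trackPos_le q J₂
    have h2 : K = width d (2 * S) (downAt d J₁) J₁ + J₂ * (2 * S) := width_downAt_add ..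
    have h3 : J₂ * (2 * S) = 2 * (J₂ * S) := by ring
    omega
  obtain ⟨L, rfl⟩ : ∃ L, J₃ = L + 1 := ⟨J₃ - 1, by omega⟩
  have hτ : τ = τ' := by
    have h1 : 2 * K + trackPos q J₂ < width d (2 * S) (downAt d J₁) (J₁ + J₂ + L + 1) := by
      rw [add_assoc _ L 1]; omega
    have h2 := student_snd_tail F q D u β τ (k := L) (by omega) ⟨_, h1⟩
    rw [hp, student_snd_tail, if_pos rfl, if_pos rfl, ← hKdef] at h2
    have hmod : (2 * K + trackPos q J₂) % K = trackPos q J₂ := by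
      rw [mul_comm, Nat.mul_add_mod, Nat.mod_eq_of_lt hpK]
    have hdiv : (2 * K + trackPos q J₂) / K = 2 := by
      rw [mul_comm, Nat.mul_add_div (by omega), Nat.div_eq_of_lt hpK]
    have hcond : (2 * K + trackPos q J₂) % K = trackPos q J₂ ∧
        (2 * K + trackPos q J₂) / K / 3 < n := ⟨hmod, by rw [hdiv]; omega⟩
    rw [knot, knot, dif_pos hcond, dif_pos hcond] at h2
    simp only [hdiv] at h2
    norm_num at h2
    linarith
  rw [hτ]

theorem hasFreeParameters_family (hd : 2 ≤ d) (hS : 1 ≤ S) (hn : 1 ≤ n) (hJ₁ : 2 ≤ J₁)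
    (hJ₂ : 1 ≤ J₂) (hJ₃ : 1 ≤ J₃)
    (hK : 2 * d ≤ width d (2 * S) (downAt d J₁) J₁)
    (hw : 3 * width d (2 * S) (downAt d J₁) (J₁ + J₂) ≤
      width d (2 * S) (downAt d J₁) (J₁ + J₂ + J₃)) :
    HasFreeParameters ((deepening (J₁ := J₁) F).family q D)
      (width d (2 * S) (downAt d J₁) (J₁ + J₂ + J₃) + J₁ * (2 * S + 2) + 3) := by
  rw [← range_parametrization]
  let ℓ : ParameterSpace S J₁ (width d (2 * S) (downAt d J₁) (J₁ + J₂ + J₃)) →L[ℝ] ℝ :=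
    (ContinuousLinearMap.proj (R := ℝ) (φ := fun _ : Fin (2 * S + 1) => ℝ) ⟨1, by omega⟩).comp
      ((ContinuousLinearMap.proj (R := ℝ) (φ := fun _ : Fin J₁ => Fin (2 * S + 1) → ℝ)
        ⟨0, by omega⟩).comp (ContinuousLinearMap.fst ℝ _ _))
  have hsurj : Function.Surjective ℓ := fun t => ⟨(fun _ _ => t, 0), rfl⟩
  exact HasFreeParameters.of_finrank (finrank_parameterSpace _ _ _) _
    (contDiff_parametrization F q D).locallyLipschitz
    (isOpen_ne_fun ℓ.continuous continuous_const)
    ((dense_compl_singleton (0 : ℝ)).preimage (ℓ.isOpenMap hsurj))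
    (injOn_parametrization F q D hd hS hn hJ₁ hJ₂ hJ₃ hK hw)

end Parameters

/-! ### Generic projections of a distribution without atoms -/

section Generic

open Filter Topology

variable {d : ℕ}

theorem ae_dotProduct_ne {x z : Fin d → ℝ} (h : x ≠ z) :
    ∀ᵐ ξ : Fin d → ℝ, ξ ⬝ᵥ x ≠ ξ ⬝ᵥ z := by
  let ℓ : (Fin d → ℝ) →ₗ[ℝ] ℝ := (dotProductBilin ℝ ℝ).flip (x - z)
  have hℓ : ∀ ξ, ℓ ξ = ξ ⬝ᵥ (x - z) := fun ξ => rfl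
  have htop : LinearMap.ker ℓ ≠ ⊤ := by
    intro htop
    have h0 : ℓ (x - z) = 0 := by rw [← LinearMap.mem_ker, htop]; trivial
    rw [hℓ, dotProduct_self_eq_zero, sub_eq_zero] at h0
    exact h h0
  have := Measure.addHaar_submodule volume (LinearMap.ker ℓ) htop
  refine measure_mono_null (fun ξ hξ => ?_) this
  simp only [mem_compl_iff, Set.mem_ofPred_eq, not_not] at hξ
  rw [SetLike.mem_coe, LinearMap.mem_ker, hℓ, dotProduct_sub, hξ, sub_self]

/-- Almost every direction `ξ` is such that the hyperplane through `z` orthogonal to `ξ` is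
negligible: by Fubini, since `z` is not an atom. -/
theorem ae_ae_dotProduct_ne (ν : Measure (Fin d → ℝ)) [SFinite ν] (z : Fin d → ℝ)
    (hz : ν {z} = 0) : ∀ᵐ ξ : Fin d → ℝ, ∀ᵐ x ∂ν, ξ ⬝ᵥ x ≠ ξ ⬝ᵥ z := by
  have hmeas : MeasurableSet {p : (Fin d → ℝ) × (Fin d → ℝ) | p.2 ⬝ᵥ p.1 ≠ p.2 ⬝ᵥ z} := by
    refine (isOpen_ne_fun ?_ ?_).measurableSet
    · exact continuous_snd.dotProduct continuous_fst
    · exact continuous_snd.dotProduct continuous_const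
  rw [← Measure.ae_ae_comm (p := fun x ξ : Fin d → ℝ => ξ ⬝ᵥ x ≠ ξ ⬝ᵥ z) hmeas]
  have hz' : ∀ᵐ x ∂ν, x ≠ z := by
    rw [ae_iff]; simpa using hz
  filter_upwards [hz'] with x hx
  exact ae_dotProduct_ne hx

theorem tendsto_measure_slab (ν : Measure (Fin d → ℝ)) [IsFiniteMeasure ν] {g : (Fin d → ℝ) → ℝ}
    (hg : Continuous g) (h : ∀ᵐ x ∂ν, g x ≠ 0) :
    Tendsto (fun m : ℕ => ν {x | |g x| < 1 / ((m : ℝ) + 1)}) atTop (𝓝 0) := by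
  have hlim := tendsto_measure_iInter_atTop (μ := ν)
    (s := fun m : ℕ => {x | |g x| < 1 / ((m : ℝ) + 1)})
    (fun m => (isOpen_lt hg.abs continuous_const).measurableSet.nullMeasurableSet)
    (fun a b hab x (hx : |g x| < _) => hx.trans_le (one_div_le_one_div_of_le (by positivity)
      (by gcongr)))
    ⟨0, measure_ne_top _ _⟩
  have h0 : ν (⋂ m : ℕ, {x | |g x| < 1 / ((m : ℝ) + 1)}) = 0 := by
    refine measure_mono_null (fun x hx => ?_) h
    simp only [mem_iInter, Set.mem_ofPred_eq, mem_compl_iff, not_not] at hx ⊢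
    by_contra hne
    obtain ⟨m, hm⟩ := exists_nat_one_div_lt (abs_pos.2 hne)
    exact absurd (hx m) (not_lt.2 hm.le)
  rwa [h0] at hlim

theorem ae_sample_injective {n : ℕ} (ρ : Measure ((Fin d → ℝ) × ℝ)) [IsProbabilityMeasure ρ]
    (h : ∀ x, ρ.fst {x} = 0) :
    ∀ᵐ D ∂(Measure.pi fun _ : Fin n => ρ), ∀ i j, i ≠ j → (D i).1 ≠ (D j).1 := by
  rw [ae_all_iff]; intro i
  rw [ae_all_iff]; intro j
  rw [ae_all_iff]; intro hij
  have hind : iIndepFun (fun (i : Fin n) (D : Fin n → (Fin d → ℝ) × ℝ) => (D i).1)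
      (Measure.pi fun _ : Fin n => ρ) :=
    iIndepFun_pi (μ := fun _ => ρ) (X := fun _ : Fin n => (Prod.fst : (Fin d → ℝ) × ℝ → Fin d → ℝ))
      fun _ => measurable_fst.aemeasurable
  have hmi : ∀ i : Fin n, Measurable fun D : Fin n → (Fin d → ℝ) × ℝ => (D i).1 := fun i =>
    measurable_fst.comp (measurable_pi_apply i)
  have hlaw : ∀ i : Fin n, (Measure.pi fun _ : Fin n => ρ).map (fun D => (D i).1) = ρ.fst := by
    intro i
    have h1 := (measurePreserving_eval (fun _ : Fin n => ρ) i).map_eq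
    rw [Measure.fst]
    nth_rw 2 [← h1]
    rw [Measure.map_map measurable_fst (measurable_pi_apply i)]
    rfl
  have hmap := (indepFun_iff_map_prod_eq_prod_map_map (hmi i).aemeasurable
    (hmi j).aemeasurable).1 (hind.indepFun hij)
  rw [hlaw, hlaw] at hmap
  have hae : ∀ᵐ p ∂(ρ.fst.prod ρ.fst), p.1 ≠ p.2 := by
    rw [Measure.ae_prod_iff_ae_ae (p := fun p : (Fin d → ℝ) × (Fin d → ℝ) => p.1 ≠ p.2)
      (isOpen_ne_fun continuous_fst continuous_snd).measurableSet]
    refine Eventually.of_forall fun x => ?_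
    rw [ae_iff]
    have : {a | ¬ x ≠ a} = {x} := by ext a; simp [eq_comm]
    rw [this, h x]
  rw [← hmap] at hae
  exact ae_of_ae_map ((hmi i).prodMk (hmi j)).aemeasurable hae

theorem ae_sample_mem {n : ℕ} (ρ : Measure ((Fin d → ℝ) × ℝ)) [IsProbabilityMeasure ρ]
    {Ω : Set (Fin d → ℝ)} (h : ∀ᵐ z ∂ρ, z.1 ∈ Ω) :
    ∀ᵐ D ∂(Measure.pi fun _ : Fin n => ρ), ∀ i, (D i).1 ∈ Ω := by
  rw [ae_all_iff]; intro i
  exact (measurePreserving_eval (fun _ : Fin n => ρ) i).quasiMeasurePreserving.ae h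

end Generic

/-! ### The error of output functions -/

section Error

variable {d : ℕ}

theorem infError_mono {ρ : Measure ((Fin d → ℝ) × ℝ)} [IsFiniteMeasure ρ] {M : ℝ}
    {F G : Set ((Fin d → ℝ) → ℝ)} (h : F ⊆ G) : infError ρ M G ≤ infError ρ M F :=
  biInf_mono h

theorem infError_le {ρ : Measure ((Fin d → ℝ) × ℝ)} [IsFiniteMeasure ρ] {M : ℝ}
    {F : Set ((Fin d → ℝ) → ℝ)} {f : (Fin d → ℝ) → ℝ} (h : f ∈ F) :
    infError ρ M F ≤ truncError ρ M f :=
  iInf₂_le f h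

theorem abs_truncation_le {M : ℝ} (hM : 0 ≤ M) (t : ℝ) : |truncation M t| ≤ M := by
  rw [abs_le, _root_.truncation]
  exact ⟨le_max_left _ _, max_le (by linarith) (min_le_left _ _)⟩

theorem continuous_truncation (M : ℝ) : Continuous (truncation M) := by
  unfold _root_.truncation; fun_prop

theorem stronglyMeasurable_regressionFunction (ρ : Measure ((Fin d → ℝ) × ℝ))
    [IsFiniteMeasure ρ] : StronglyMeasurable (regressionFunction ρ) :=
  stronglyMeasurable_id.integral_kernel

/-- Changing a function on a set of measure `ε` changes the truncated error by at most
`2M √ε`. -/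
theorem truncError_le_add {ρ : Measure ((Fin d → ℝ) × ℝ)} [IsFiniteMeasure ρ] {M : ℝ}
    (hM : 0 ≤ M) {f g : (Fin d → ℝ) → ℝ} (hf : Continuous f) (hg : Continuous g)
    {A : Set (Fin d → ℝ)} (hA : MeasurableSet A) (h : ∀ᵐ x ∂ρ.fst, x ∉ A → f x = g x) :
    truncError ρ M f ≤ truncError ρ M g + ENNReal.ofReal (2 * M) * ρ.fst A ^ (1 / 2 : ℝ) := by
  have hmf : AEStronglyMeasurable (fun x => truncation M (f x)) ρ.fst :=
    ((continuous_truncation M).comp hf).aestronglyMeasurable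
  have hmg : AEStronglyMeasurable (fun x => truncation M (g x)) ρ.fst :=
    ((continuous_truncation M).comp hg).aestronglyMeasurable
  have hmr := (stronglyMeasurable_regressionFunction ρ).aestronglyMeasurable (μ := ρ.fst)
  have hsplit : (fun x => truncation M (f x) - regressionFunction ρ x) =
      (fun x => truncation M (g x) - regressionFunction ρ x) +
        fun x => truncation M (f x) - truncation M (g x) := by
    funext x; simp
  have hle : eLpNorm (fun x => truncation M (f x) - truncation M (g x)) 2 ρ.fst ≤
      eLpNorm (A.indicator fun _ => 2 * M) 2 ρ.fst := by
    refine eLpNorm_mono_ae ?_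
    filter_upwards [h] with x hx
    by_cases hxA : x ∈ A
    · rw [Set.indicator_of_mem hxA, Real.norm_eq_abs, Real.norm_eq_abs,
        abs_of_nonneg (by linarith : 0 ≤ 2 * M)]
      refine (abs_sub _ _).trans ?_
      linarith [abs_truncation_le hM (f x), abs_truncation_le hM (g x)]
    · rw [hx hxA, sub_self, norm_zero]; exact norm_nonneg _
  rw [eLpNorm_indicator_const hA (by norm_num) (by norm_num)] at hle
  rw [truncError, hsplit]
  refine (eLpNorm_add_le (hmg.sub hmr) (hmf.sub hmg) (by norm_num)).trans ?_
  refine add_le_add le_rfl (hle.trans (le_of_eq ?_))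
  rw [Real.enorm_eq_ofReal (by linarith)]
  norm_num

theorem continuous_of_mem_outputs {s : ℕ} {m : ℕ → ℕ} {J : ℕ} {p : Weights d s m J}
    {f : (Fin d → ℝ) → ℝ} (hf : f ∈ outputs p) : Continuous f := by
  obtain ⟨c, a, rfl⟩ := hf
  exact (continuous_const.dotProduct (continuous_layer p J le_rfl)).add continuous_const

theorem layer_eq_of_filter_eq_zero {s : ℕ} {m : ℕ → ℕ} {J : ℕ} (p : Weights d s m J) {j : ℕ}
    (hj : j < J) (h0 : p.1 ⟨j, hj⟩ = 0) (x y : Fin d → ℝ) (k : ℕ) (hk : j + 1 + k ≤ J) :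
    layer p x (j + 1 + k) hk = layer p y (j + 1 + k) hk := by
  induction k with
  | zero =>
    funext i
    have hz : convMatrix (width d s m j) (0 : Fin (s + 1) → ℝ) = 0 := by
      ext a b; simp [convMatrix]
    change layer p x (j + 1) hj i = layer p y (j + 1) hj i
    simp only [layer, h0, hz, Matrix.zero_mulVec]
  | succ k ih =>
    funext i
    change layer p x (j + 1 + k + 1) hk i = layer p y (j + 1 + k + 1) hk i
    simp only [layer, ih (by omega)]

/-- Teachers with a vanishing filter have constant output functions only, so that one may assume
that no filter vanishes. -/
theorem exists_teacher_filters_ne_zero {s : ℕ} {m : ℕ → ℕ} {J : ℕ} {f : (Fin d → ℝ) → ℝ}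
    (hf : f ∈ hypothesisSpace d s m J) :
    ∃ q : Weights d s m J, (∀ j, q.1 j ≠ 0) ∧ f ∈ outputs q := by
  obtain ⟨p, hp⟩ := hf
  by_cases h : ∀ j, p.1 j ≠ 0
  · exact ⟨p, h, hp⟩
  push Not at h
  obtain ⟨⟨j, hj⟩, h0⟩ := h
  obtain ⟨k, rfl⟩ := Nat.exists_eq_add_of_le (Nat.succ_le_of_lt hj)
  obtain ⟨c, a, rfl⟩ := hp
  -- After a vanishing filter the network is constant, and constants need no output coefficients.
  refine ⟨(fun _ _ => 1, p.2), fun j h1 => one_ne_zero (congrFun h1 0), 0,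
    c ⬝ᵥ layer p 0 _ le_rfl + a, ?_⟩
  funext x
  rw [zero_dotProduct, zero_add]
  have := layer_eq_of_filter_eq_zero p hj h0 x 0 k le_rfl
  exact congrArg (fun v => c ⬝ᵥ v + a) this

end Error

/-! ### Interpolation -/

section Interpolation

open Filter Topology

variable {d S n J₁ J₂ J₃ : ℕ}

theorem trackCoeff_ne_zero {q : Weights d S plain J₂} (hq : ∀ j, q.1 j ≠ 0) :
    trackCoeff q J₂ ≠ 0 := by
  refine Finset.prod_ne_zero_iff.2 fun j hj => leadingCoeff_ne_zero.2 ?_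
  rw [filterPoly_of_lt q (Finset.mem_range.1 hj)]
  exact (map_ne_zero_iff _ (injective_ofFn (S + 1))).2 (hq _)

theorem exists_layer_bound (q : Weights d S plain J₂) (u : Fin J₁ → Fin (2 * S + 1) → ℝ)
    {Ω : Set (Fin d → ℝ)} (hΩ : IsCompact Ω) :
    ∃ B : ℝ, ∀ x ∈ Ω, (∀ k ≤ J₁, ∀ i, |(partialProd u k * ofFn d x).coeff i| ≤ B) ∧
      ∀ i, |layer q x J₂ le_rfl i| ≤ B := by
  obtain ⟨r, hr⟩ := hΩ.exists_bound_of_continuousOn continuousOn_id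
  obtain ⟨t, ht⟩ := hΩ.exists_bound_of_continuousOn (continuous_layer q J₂ le_rfl).continuousOn
  have hnn : ∀ k, 0 ≤ coeffNorm (partialProd u k) * |r| := fun k =>
    mul_nonneg (coeffNorm_nonneg _) (abs_nonneg _)
  have hsum : 0 ≤ ∑ k ∈ range (J₁ + 1), coeffNorm (partialProd u k) * |r| :=
    Finset.sum_nonneg fun k _ => hnn k
  refine ⟨∑ k ∈ range (J₁ + 1), coeffNorm (partialProd u k) * |r| + |t|,
    fun x hx => ⟨fun k hk i => ?_, fun i => ?_⟩⟩
  · have hx' : ∀ i, |(ofFn d x).coeff i| ≤ |r| := by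
      intro i
      by_cases hi : i < d
      · rw [ofFn_coeff_eq_val_of_lt _ hi]
        exact (norm_le_pi_norm x ⟨i, hi⟩).trans ((hr x hx).trans (le_abs_self r))
      · rw [ofFn_coeff_eq_zero_of_ge _ (not_lt.1 hi), abs_zero]; exact abs_nonneg r
    refine (abs_coeff_mul_le _ _ hx' i).trans ?_
    have := Finset.single_le_sum (f := fun k => coeffNorm (partialProd u k) * |r|)
      (fun k _ => hnn k) (Finset.mem_range.2 (Nat.lt_succ_of_le hk))
    linarith [abs_nonneg t]
  · have := (norm_le_pi_norm (layer q x J₂ le_rfl) i).trans ((ht x hx).trans (le_abs_self t))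
    rw [Real.norm_eq_abs] at this
    linarith

/-- If the inputs of the data are distinct and are not atoms, the deepened network of a teacher
without vanishing filters interpolates the data with an error as close as one likes to that of
the teacher: for a generic direction `ξ`, the hats around the data are eventually disjoint
and supported on sets of arbitrarily small measure. -/
theorem exists_interpolating_student {N : ℕ} (hd : 0 < d) (hJ₁ : 1 ≤ J₁) (hJ₂ : 1 ≤ J₂)
    (hJ₃ : 1 ≤ J₃) (hdJ : 2 * d * d ≤ 2 * S * J₁)
    (hK : 2 * d ≤ width d (2 * S) (downAt d J₁) J₁) (hN : 3 * n ≤ N) (hN1 : 1 ≤ N)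
    (hJN : (N - 1) * width d (2 * S) (downAt d J₁) (J₁ + J₂) ≤ 2 * S * J₃)
    {F : Fin J₃ → Fin (2 * S + 1) → ℝ}
    (hF : partialProd F J₃ = ∑ m ∈ range N, X ^ (m * width d (2 * S) (downAt d J₁) (J₁ + J₂)))
    {M : ℝ} (hM : 0 ≤ M) {ρ : Measure ((Fin d → ℝ) × ℝ)} [IsProbabilityMeasure ρ]
    {Ω : Set (Fin d → ℝ)} (hΩ : IsCompact Ω) (hρΩ : ∀ᵐ x ∂ρ.fst, x ∈ Ω)
    (hρ : ∀ x, ρ.fst {x} = 0) {q : Weights d S plain J₂} (hq : ∀ j, q.1 j ≠ 0)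
    {g : (Fin d → ℝ) → ℝ} (hg : g ∈ outputs q) {E : ℝ≥0∞} (hgE : truncError ρ M g < E)
    {D : Sample d n} (hDΩ : ∀ i, (D i).1 ∈ Ω) (hD : ∀ i j, i ≠ j → (D i).1 ≠ (D j).1) :
    ∃ u β τ, infError ρ M (outputs ((deepening (J₁ := J₁) F).student q D u β τ) ∩
      interpolants D) < E := by
  have hgen : ∀ᵐ ξ : Fin d → ℝ, (∀ i, ∀ᵐ x ∂ρ.fst, ξ ⬝ᵥ x ≠ ξ ⬝ᵥ (D i).1) ∧
      ∀ i j, i ≠ j → ξ ⬝ᵥ (D i).1 ≠ ξ ⬝ᵥ (D j).1 := by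
    refine Filter.Eventually.and (ae_all_iff.2 fun i => ae_ae_dotProduct_ne _ _ (hρ _)) ?_
    exact ae_all_iff.2 fun i => ae_all_iff.2 fun j => ae_all_iff.2 fun hij =>
      ae_dotProduct_ne (hD i j hij)
  obtain ⟨ξ, hξ, hξD⟩ := hgen.exists
  obtain ⟨u, hu, hproj⟩ := exists_routing (S := S) (J₂ := J₂) hd hJ₁ hdJ ξ
  obtain ⟨B, hB⟩ := exists_layer_bound q u hΩ
  have ha := trackCoeff_ne_zero hq
  set a := trackCoeff q J₂
  let t : Fin n → (Fin d → ℝ) → ℝ := fun i x => a * (projection u x - projection u (D i).1)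
  have ht : ∀ i, Continuous (t i) := by
    intro i
    simp only [t, hproj]
    exact continuous_const.mul
      ((continuous_const.dotProduct continuous_id).sub continuous_const)
  have ht0 : ∀ i, ∀ᵐ x ∂ρ.fst, t i x ≠ 0 := by
    intro i
    filter_upwards [hξ i] with x hx
    simp only [t, hproj]
    exact mul_ne_zero ha (sub_ne_zero.2 hx)
  let A : ℕ → Set (Fin d → ℝ) := fun m => ⋃ i, {x | |t i x| < 1 / ((m : ℝ) + 1)}
  have hAm : ∀ m, MeasurableSet (A m) := fun m =>
    MeasurableSet.iUnion fun i => (isOpen_lt (ht i).abs continuous_const).measurableSet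
  have hA : Tendsto (fun m => ρ.fst (A m)) atTop (𝓝 0) := by
    have h1 : Tendsto (fun m : ℕ => ∑ i, ρ.fst {x | |t i x| < 1 / ((m : ℝ) + 1)}) atTop
        (𝓝 (∑ _i : Fin n, 0)) :=
      tendsto_finsetSum _ fun i _ => tendsto_measure_slab _ (ht i) (ht0 i)
    rw [Finset.sum_const_zero] at h1
    refine tendsto_of_tendsto_of_tendsto_of_le_of_le tendsto_const_nhds h1
      (fun _ => zero_le) fun m => ?_
    exact measure_iUnion_fintype_le _ _
  have hsmall : ∀ᶠ m in atTop,
      truncError ρ M g + ENNReal.ofReal (2 * M) * ρ.fst (A m) ^ (1 / 2 : ℝ) < E := by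
    have h1 : Tendsto (fun m => truncError ρ M g +
        ENNReal.ofReal (2 * M) * ρ.fst (A m) ^ (1 / 2 : ℝ)) atTop
        (𝓝 (truncError ρ M g + ENNReal.ofReal (2 * M) * 0 ^ (1 / 2 : ℝ))) :=
      tendsto_const_nhds.add (ENNReal.Tendsto.const_mul (hA.ennrpow_const _)
        (Or.inr ENNReal.ofReal_ne_top))
    rw [ENNReal.zero_rpow_of_pos (by norm_num), mul_zero, add_zero] at h1
    exact h1.eventually_lt_const hgE
  have hsep : ∀ᶠ m : ℕ in atTop, ∀ i j, i ≠ j → 1 / ((m : ℝ) + 1) ≤ |t j (D i).1| := by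
    rw [eventually_all]; intro i
    rw [eventually_all]; intro j
    rw [eventually_all]; intro hij
    refine (tendsto_one_div_add_atTop_nhds_zero_nat (𝕜 := ℝ)).eventually_le_const ?_
    refine abs_pos.2 (mul_ne_zero ha (sub_ne_zero.2 ?_))
    rw [hproj, hproj]
    exact hξD i j hij
  obtain ⟨m, hm1, hm2⟩ := (hsmall.and hsep).exists
  set τ : ℝ := 1 / ((m : ℝ) + 1)
  have hτ : 0 < τ := by positivity
  obtain ⟨c, a₀, hgc⟩ := id hg
  obtain ⟨f, hf, hfeq⟩ := exists_output_student F q D u τ (B := B) hd hJ₁ hJ₂ hJ₃ hK (hu q) hN hN1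
    hJN hF c a₀ (fun i => (D i).2 - g (D i).1)
  have hfΩ : ∀ x ∈ Ω, f x = g x + ∑ i, ((D i).2 - g (D i).1) * hat τ (t i x) := by
    intro x hx
    rw [hfeq x (hB x hx).1 (hB x hx).2]
    congr 1
    rw [hgc]
  refine ⟨u, headShifts J₁ B, τ, lt_of_le_of_lt (infError_le (f := f) ⟨hf, fun i => ?_⟩) ?_⟩
  · rw [hfΩ _ (hDΩ i), Finset.sum_eq_single i]
    · have : t i (D i).1 = 0 := by simp [t]
      rw [this, hat_zero hτ]; ring
    · intro j _ hji
      rw [hat_eq_zero hτ (hm2 i j hji.symm), mul_zero]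
    · exact fun h => absurd (Finset.mem_univ i) h
  · refine lt_of_le_of_lt (truncError_le_add hM (continuous_of_mem_outputs hf)
      (continuous_of_mem_outputs hg) (hAm m) ?_) hm1
    filter_upwards [hρΩ] with x hx hxA
    rw [hfΩ x hx, Finset.sum_eq_zero, add_zero]
    intro i _
    rw [hat_eq_zero hτ, mul_zero]
    by_contra hlt
    exact hxA (Set.mem_iUnion.2 ⟨i, not_le.1 hlt⟩)

end Interpolation

/-! ### Depths and widths -/

section Depths

theorem le_depthOne_mul {d S : ℕ} (hS : 1 ≤ S) : 2 * d * d ≤ (2 * S - 1) * depthOne d (2 * S) := by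
  have hS' : (1 : ℚ) ≤ S := by exact_mod_cast hS
  have h := Nat.le_ceil ((2 * (d : ℚ) ^ 2) / (((2 * S : ℕ) : ℚ) - 1))
  rw [div_le_iff₀ (by push_cast; linarith)] at h
  have h2 : (((2 * S - 1 : ℕ)) : ℚ) = ((2 * S : ℕ) : ℚ) - 1 := by
    rw [Nat.cast_sub (by omega)]; simp
  rw [← h2] at h
  have h3 : ((2 * d ^ 2 : ℕ) : ℚ) ≤ ((depthOne d (2 * S) * (2 * S - 1) : ℕ) : ℚ) := by
    unfold depthOne
    push_cast at h ⊢
    rw [h2] at h ⊢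
    push_cast at h ⊢
    linarith
  have h4 : 2 * d ^ 2 ≤ depthOne d (2 * S) * (2 * S - 1) := by exact_mod_cast h3
  calc 2 * d * d = 2 * d ^ 2 := by ring
    _ ≤ _ := h4.trans (le_of_eq (mul_comm _ _))

theorem le_mul_depthThree {d S J₁ J₂ N : ℕ} (hS : 1 ≤ S) (hN : 1 ≤ N) :
    (N - 1) * width d (2 * S) (downAt d J₁) (J₁ + J₂) ≤ 2 * S * depthThree d (2 * S) J₁ J₂ N := by
  have hS' : (1 : ℚ) ≤ S := by exact_mod_cast hS
  have h := Nat.le_ceil (((N : ℚ) - 1) * (width d (2 * S) (downAt d J₁) (J₁ + J₂) : ℚ) /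
    ((2 * S : ℕ) : ℚ))
  rw [div_le_iff₀ (by push_cast; linarith)] at h
  have h2 : (((N - 1 : ℕ)) : ℚ) = (N : ℚ) - 1 := by
    rw [Nat.cast_sub hN]; simp
  rw [← h2] at h
  rw [mul_comm (2 * S), depthThree, ← h2]
  exact_mod_cast h

end Depths

end Construction

/-! ### Conclusion -/

theorem theorem1 (d S J₁ J₂ J₃ n N : ℕ) (hd : 2 ≤ d) (hS : 1 ≤ S) (hSd : (S : ℝ) ≤ (d : ℝ) / 2)
    (hJ₂ : 1 ≤ J₂) (hn : 1 ≤ n) (hN : Odd N) (hNn : 3 * n ≤ N)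
    (hJ₁ : J₁ = depthOne d (2 * S)) (hJ₃ : J₃ = depthThree d (2 * S) J₁ J₂ N)
    (Ω : Set (Fin d → ℝ)) (hΩ : IsClosed Ω) (hΩb : Bornology.IsBounded Ω) :
    ∃ R : DeepeningRule d S n J₁ J₂ J₃,
      (∀ (q : Weights d S plain J₂) (D : Sample d n),
        HasFreeParameters (R.family q D)
          (width d (2 * S) (downAt d J₁) (J₁ + J₂ + J₃) + J₁ * (2 * S + 2) + 3)) ∧
      ∀ (M : ℝ) (_ : 1 ≤ M) (ρ : Measure ((Fin d → ℝ) × ℝ)) [IsProbabilityMeasure ρ]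
        (_ : ∀ᵐ z ∂ρ, z ∈ Ω ×ˢ Icc (-M) M) (_ : ∀ x ∈ Ω, ρ.fst {x} = 0)
        (E : ℝ) (_ : 0 < E)
        (_ : infError ρ M (hypothesisSpace d S plain J₂) < ENNReal.ofReal E),
        (∀ᵐ D ∂(Measure.pi fun _ : Fin n => ρ),
          infError ρ M (hypothesisSpace d (2 * S) (downAt d J₁) (J₁ + J₂ + J₃) ∩ interpolants D)
            < ENNReal.ofReal E) ∧
        (∃ q : Weights d S plain J₂,
          infError ρ M (outputs q) < ENNReal.ofReal E ∧
          (∀ᵐ D ∂(Measure.pi fun _ : Fin n => ρ), ∃ u β τ,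
            infError ρ M (outputs (R.student q D u β τ) ∩ interpolants D)
              < ENNReal.ofReal E)) := by
  have hS2 : 2 * S ≤ d := by
    have : ((2 * S : ℕ) : ℝ) ≤ d := by push_cast; linarith
    exact_mod_cast this
  have hdJ := le_depthOne_mul (d := d) hS
  rw [← hJ₁] at hdJ
  have hJ₁2 : 2 ≤ J₁ := by
    -- One layer is not enough, because `2S - 1 < d ≤ 2d²`.
    by_contra h
    have h1 := Nat.mul_le_mul_left (2 * S - 1) (show J₁ ≤ 1 by omega)
    have h2 : d ≤ 2 * d * d := Nat.le_mul_of_pos_left d (by omega)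
    omega
  have hdJ' : 2 * d * d ≤ 2 * S * J₁ := hdJ.trans (Nat.mul_le_mul_right _ (by omega))
  have hK : 2 * d ≤ width d (2 * S) (downAt d J₁) J₁ := by
    rw [width_downAt_eq _ _ _ (by omega), Nat.le_div_iff_mul_le (by omega), mul_comm J₁]
    omega
  have hJN := le_mul_depthThree (d := d) (J₁ := J₁) (J₂ := J₂) (N := N) hS (by omega)
  rw [← hJ₃] at hJN
  set K := width d (2 * S) (downAt d J₁) (J₁ + J₂) with hKdef
  have hK0 : 0 < K := by rw [hKdef, width_downAt_add]; omega
  have h2K : 2 * K ≤ (N - 1) * K := Nat.mul_le_mul_right K (by omega)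
  have hJ₃1 : 1 ≤ J₃ := by
    rcases Nat.eq_zero_or_pos J₃ with h | h
    · rw [h, mul_zero] at hJN; omega
    · exact h
  have hw : 3 * K ≤ width d (2 * S) (downAt d J₁) (J₁ + J₂ + J₃) := by
    have h1 : width d (2 * S) (downAt d J₁) (J₁ + J₂ + J₃) = K + 2 * S * J₃ := by
      rw [hKdef, add_assoc, width_downAt_add, width_downAt_add]; ring
    omega
  obtain ⟨F, hF⟩ := exists_copy_filters hJ₃1 hJN
  refine ⟨deepening F, fun q D => hasFreeParameters_family F q D hd hS hn hJ₁2 hJ₂ hJ₃1 hK hw, ?_⟩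
  intro M hM ρ _ hρΩ hatom E _ hE
  have hρΩ1 : ∀ᵐ z ∂ρ, z.1 ∈ Ω := hρΩ.mono fun z hz => hz.1
  have hfst : ∀ᵐ x ∂ρ.fst, x ∈ Ω :=
    (ae_map_iff measurable_fst.aemeasurable hΩ.measurableSet).2 hρΩ1
  have hnull : ∀ x, ρ.fst {x} = 0 := by
    intro x
    by_cases hx : x ∈ Ω
    · exact hatom x hx
    · refine measure_mono_null (fun y hy => ?_) hfst
      rw [Set.mem_singleton_iff.1 hy]
      exact hx
  obtain ⟨g, hg, hgE⟩ : ∃ g ∈ hypothesisSpace d S plain J₂, truncError ρ M g < ENNReal.ofReal E := by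
    simpa [infError, iInf_lt_iff] using hE
  obtain ⟨q, hq, hgq⟩ := exists_teacher_filters_ne_zero hg
  have hmain : ∀ᵐ D ∂(Measure.pi fun _ : Fin n => ρ), ∃ u β τ,
      infError ρ M (outputs ((deepening (J₁ := J₁) F).student q D u β τ) ∩ interpolants D)
        < ENNReal.ofReal E := by
    filter_upwards [ae_sample_mem ρ hρΩ1, ae_sample_injective ρ hnull] with D hDΩ hD
    exact exists_interpolating_student (by omega) (by omega) hJ₂ hJ₃1 hdJ' hK hNn (by omega) hJN hF
      (by linarith) (Metric.isCompact_of_isClosed_isBounded hΩ hΩb) hfst hnull hq hgq hgE hDΩ hD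
  refine ⟨?_, q, (infError_le hgq).trans_lt hgE, hmain⟩
  filter_upwards [hmain] with D hD
  obtain ⟨u, β, τ, h⟩ := hD
  refine (infError_mono ?_).trans_lt h
  exact Set.inter_subset_inter_left _ fun f hf => ⟨_, hf⟩
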